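/- Let $N\ge 3$ be an integer and $2^*=\frac{2N}{N-2}$. Let $\mathcal S$ be the best constant in the Sobolev inequality on $\mathbb R^N$, that is, the largest constant such that $$\mathcal S\,\|f\|_{2^*}^2\le\|\nabla f\|_2^2\qquad\text{for all } f\in\dot H^1(\mathbb R^N),$$ where $\dot H^1(\mathbb R^N)\subset L^{2^*}(\mathbb R^N)$ is the completion of $C_c^\infty(\mathbb R^N)$ for the norm $\|\nabla\varphi\|_2$. For $\varepsilon>0$ put $$u_\varepsilon(x)=\frac{[N(N-2)\varepsilon^2]^{\frac{N-2}{4}}}{[\varepsilon^2+|x|^2]^{\frac{N-2}{2}}},\qquad x\in\mathbb R^N.$$ Let $\xi\in C_c^\infty(\mathbb R^N)$ be a radially non-increasing cut-off function with $\xi\equiv1$ in $B_1$ and $\xi\equiv0$ in $\mathbb R^N\setminus B_2$, and write $\xi(r)$ for its value on the sphere $|x|=r$. Set $U_\varepsilon=\xi u_\varepsilon$ and let $\omega$ be the area of the unit sphere in $\mathbb R^N$. Then, as $\varepsilon\to0^+$: (i) $\|\nabla U_\varepsilon\|_2^2=\mathcal S^{N/2}+O(\varepsilon^{N-2})$ and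 $\|U_\varepsilon\|_{2^*}^{2^*}=\mathcal S^{N/2}+O(\varepsilon^N)$. (ii) If $\frac{N}{N-2}<q<2^*$, there is a constant $K>0$ such that $$\|U_\varepsilon\|_q^q=K\varepsilon^{N-\frac{N-2}{2}q}+o\big(\varepsilon^{N-\frac{N-2}{2}q}\big);$$ if $q=\frac{N}{N-2}$, then $$\|U_\varepsilon\|_q^q=[N(N-2)]^{\frac N4}\,\omega\,\varepsilon^{\frac N2}|\log\varepsilon|+O\big(\varepsilon^{\frac N2}\big);$$ if $1\le q<\frac{N}{N-2}$, then the integral below converges and $$\|U_\varepsilon\|_q^q=[N(N-2)]^{\frac{(N-2)q}{4}}\,\omega\left(\int_0^2\frac{\xi(r)^q}{r^{(N-2)q-(N-1)}}\,dr\right)\varepsilon^{\frac{N-2}{2}q}+o\big(\varepsilon^{\frac{N-2}{2}q}\big).$$ -/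

import Mathlib

open MeasureTheory Filter Topology Asymptotics
open scoped ContDiff Gradient

noncomputable section

namespace TalentiBubble

/-- Euclidean space of dimension `N`. -/
abbrev E (N : ℕ) : Type := EuclideanSpace ℝ (Fin N)

/-- The critical Sobolev exponent `2N/(N-2)` (used for `N ≥ 3`). -/
def critExp (N : ℕ) : ℝ := 2 * (N : ℝ) / ((N : ℝ) - 2)

/-- `f` belongs to the homogeneous Sobolev space of order one over `L²` and `g` is its gradient:
the space is the completion of the smooth compactly supported functions for the norm
`‖∇φ‖₂`, realised inside the Lebesgue space with the critical exponent. -/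
def MemHomogSobolev (N : ℕ) (f : E N → ℝ) (g : E N → E N) : Prop :=
  MemLp f (ENNReal.ofReal (critExp N)) volume ∧ MemLp g 2 volume ∧
  ∃ φ : ℕ → E N → ℝ,
    (∀ n, ContDiff ℝ ∞ (φ n) ∧ HasCompactSupport (φ n)) ∧
    Tendsto (fun n => eLpNorm (fun x => φ n x - f x) (ENNReal.ofReal (critExp N)) volume)
      atTop (𝓝 0) ∧
    Tendsto (fun n => eLpNorm (fun x => ∇ (φ n) x - g x) 2 volume) atTop (𝓝 0)

/-- The best constant in the Sobolev inequality `s ‖f‖² ≤ ‖∇f‖₂²`, where the norm of `f` is the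
one with the critical exponent. -/
def sobolevConst (N : ℕ) : ℝ :=
  sSup {s : ℝ | ∀ (f : E N → ℝ) (g : E N → E N), MemHomogSobolev N f g →
    s * lpNorm f (ENNReal.ofReal (critExp N)) volume ^ 2 ≤ lpNorm g 2 volume ^ 2}

/-- The area of the unit sphere in dimension `N`. -/
def sphereArea (N : ℕ) : ℝ := (volume : Measure (E N)).toSphere.real Set.univ

/-- The extremal function (Aubin-Talenti bubble) of parameter `ε > 0`. -/
def bubble (N : ℕ) (ε : ℝ) (x : E N) : ℝ :=
  ((N : ℝ) * ((N : ℝ) - 2) * ε ^ 2) ^ (((N : ℝ) - 2) / 4) /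
    (ε ^ 2 + ‖x‖ ^ 2) ^ (((N : ℝ) - 2) / 2)

/-- Smooth, radially non-increasing cut-off functions, equal to `1` on the unit ball and to `0`
outside the ball of radius `2`. The condition `antitone` contains that `ξ` is radial. -/
structure IsCutoff (N : ℕ) (ξ : E N → ℝ) : Prop where
  smooth : ContDiff ℝ ∞ ξ
  antitone : ∀ x y : E N, ‖x‖ ≤ ‖y‖ → ξ y ≤ ξ x
  eq_one : ∀ x ∈ Metric.ball (0 : E N) 1, ξ x = 1
  eq_zero : ∀ x ∉ Metric.ball (0 : E N) 2, ξ x = 0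

/-- The truncated bubble. -/
def truncBubble (N : ℕ) (ξ : E N → ℝ) (ε : ℝ) (x : E N) : ℝ := ξ x * bubble N ε x

end TalentiBubble

end

noncomputable section

namespace TalentiBubble

/-! ### The Knothe map -/

/-! Two independent facts are combined: the sharp Sobolev constant satisfies `sobolevConst N ^ (N /
2) = bubbleEnergy N`, and the norms of the truncated bubble have elementary expansions in ε.

Lower bound for the constant (`sobolev_inequality_test`): mass transport. Given a test function φ,
let F be the multiple of |φ|^{2*} having the mass of a positive density G on a cube, and let T be
the Knothe map from F to G: T_i depends only on x_i, x_{i+1}, ... and is nondecreasing in x_i, so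
the Jacobian is the product of the diagonal derivatives a_i and F = G(T) ∏ a_i. The
arithmetic-geometric mean inequality gives G(T)^{-1/N} F ≤ F^{1-1/N} (1/N) ∑ a_i. Integrating, then
integrating by parts one coordinate at a time, gives ∫ G^{1-1/N} ≤ -(1/N) ∫ ∇(F^{1-1/N}) · T. By
Cauchy-Schwarz the right side is controlled by ‖∇φ‖₂ and ∫ |y|² G (`integral_cube_rpow_le`). Only
the diagonal derivatives of T enter, so T need not be differentiable as a map. For G = u₁^{2*} on
growing cubes, all integrals of G are explicit multiples of one number (`kernelInt_sub_one`), and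
the constants cancel exactly.

Upper bound: the truncated bubbles are test functions whose Dirichlet integral and critical integral
both tend to `bubbleEnergy N` (`sobolevConst_eq`).

Expansions: with β = (N-2)q/2, ‖U_ε‖_q^q is a constant times ε^β ∫ ξ^q (ε²+|x|²)^{-β}. If 2β > N the
untruncated integral scales like ε^{N-2β} and the cut-off costs O(1). If 2β = N the integral over
the unit ball is ω|log ε| + O(1). If 2β < N the integral converges to ∫ ξ^q |x|^{-2β} by dominated
convergence. -/

/-- The closed cube of side `2 * R` centred at the origin. -/
def cube (n : ℕ) (R : ℝ) : Set (Fin n → ℝ) := Set.univ.pi fun _ => Set.Icc (-R) R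

lemma measurableSet_cube (n : ℕ) (R : ℝ) : MeasurableSet (cube n R) :=
  MeasurableSet.univ_pi fun _ => measurableSet_Icc

lemma isCompact_cube (n : ℕ) (R : ℝ) : IsCompact (cube n R) :=
  isCompact_univ_pi fun _ => isCompact_Icc

lemma mem_cube {n : ℕ} {R : ℝ} {x : Fin n → ℝ} : x ∈ cube n R ↔ ∀ i, x i ∈ Set.Icc (-R) R := by
  simp only [cube, Set.mem_univ_pi]

lemma cons_mem_cube {n : ℕ} {R : ℝ} {t : ℝ} {x : Fin n → ℝ} :
    (Fin.cons t x : Fin (n + 1) → ℝ) ∈ cube (n + 1) R ↔ t ∈ Set.Icc (-R) R ∧ x ∈ cube n R := by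
  simp only [mem_cube, Fin.forall_fin_succ, Fin.cons_zero, Fin.cons_succ]

lemma measurable_cons {n : ℕ} :
    Measurable fun p : ℝ × (Fin n → ℝ) => (Fin.cons p.1 p.2 : Fin (n + 1) → ℝ) := by
  refine measurable_pi_iff.2 fun i => ?_
  refine Fin.cases ?_ (fun j => ?_) i
  · simpa using measurable_fst
  · exact (measurable_pi_apply j).comp measurable_snd

lemma continuous_cons {n : ℕ} :
    Continuous fun p : ℝ × (Fin n → ℝ) => (Fin.cons p.1 p.2 : Fin (n + 1) → ℝ) := by
  refine continuous_pi fun i => ?_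
  refine Fin.cases ?_ (fun j => ?_) i
  · simpa using continuous_fst
  · exact (continuous_apply j).comp continuous_snd

lemma measurable_tail {n : ℕ} :
    Measurable fun x : Fin (n + 1) → ℝ => (Fin.tail x : Fin n → ℝ) :=
  measurable_pi_iff.2 fun i => measurable_pi_apply i.succ

lemma lintegral_cube_succ {n : ℕ} {R : ℝ} {f : (Fin (n + 1) → ℝ) → ENNReal} (hf : Measurable f) :
    ∫⁻ x in cube (n + 1) R, f x =
      ∫⁻ x in cube n R, ∫⁻ t in Set.Icc (-R) R, f (Fin.cons t x) := by
  have h := measurePreserving_piFinSuccAbove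
    (fun _ : Fin (n + 1) => (volume : Measure ℝ).restrict (Set.Icc (-R) R)) 0
  have h1 : (volume : Measure (Fin (n + 1) → ℝ)).restrict (cube (n + 1) R) =
      Measure.pi fun _ => (volume : Measure ℝ).restrict (Set.Icc (-R) R) := by
    rw [cube, volume_pi, Measure.restrict_pi_pi]
  have h2 : (volume : Measure (Fin n → ℝ)).restrict (cube n R) =
      Measure.pi fun _ => (volume : Measure ℝ).restrict (Set.Icc (-R) R) := by
    rw [cube, volume_pi, Measure.restrict_pi_pi]
  rw [h1, h2]
  have h3 := h.symm.lintegral_comp hf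
  rw [← h3, lintegral_prod_symm]
  · simp [MeasurableEquiv.piFinSuccAbove, Fin.insertNthEquiv]
  · exact (hf.comp h.symm.measurable).aemeasurable

/-! ### Monotone transport on a line, and marginals -/

/-- The primitive of g is strictly increasing, so near t the function S must coincide with its local
inverse composed with θ. No continuity of S is assumed; it comes from this identification. -/
lemma hasDerivAt_of_integral_eq {g θ S : ℝ → ℝ} {a θ' t : ℝ} (hg : Continuous g)
    (hg0 : ∀ s, 0 < g s) (hS : ∀ t, ∫ s in a..S t, g s = θ t) (hθ : HasDerivAt θ θ' t) :
    HasDerivAt S (θ' / g (S t)) t := by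
  have hH : ∀ s, HasStrictDerivAt (fun u => ∫ s in a..u, g s) (g s) s := fun s =>
    intervalIntegral.integral_hasStrictDerivAt_right (hg.intervalIntegrable _ _)
      (hg.stronglyMeasurableAtFilter _ _) hg.continuousAt
  have hmono : StrictMono (fun u => ∫ s in a..u, g s) :=
    strictMono_of_deriv_pos fun s => by rw [(hH s).hasDerivAt.deriv]; exact hg0 s
  have hinv := (hH (S t)).to_localInverse (hg0 _).ne'
  have hright := (hH (S t)).eventually_right_inverse (hg0 _).ne'
  have h2 := hS t
  simp only [h2] at hinv hright
  have h3 := (hinv.hasDerivAt.comp t hθ)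
  have h4 := hθ.continuousAt.eventually hright
  rw [div_eq_mul_inv, mul_comm]
  refine h3.congr_of_eventuallyEq ?_
  filter_upwards [h4] with u hu
  refine hmono.injective ?_
  simp only [hS u]
  exact hu.symm

lemma exists_integral_eq {g : ℝ → ℝ} {M θ : ℝ} (hM : 0 ≤ M) (hg : Continuous g)
    (h0 : 0 ≤ θ) (h1 : θ ≤ ∫ s in (-M)..M, g s) :
    ∃ c ∈ Set.Icc (-M) M, ∫ s in (-M)..c, g s = θ := by
  have hc : ContinuousOn (fun u => ∫ s in (-M)..u, g s) (Set.Icc (-M) M) :=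
    (intervalIntegral.continuous_primitive (fun _ _ => hg.intervalIntegrable _ _) _).continuousOn
  have := intermediate_value_Icc (by linarith) hc
  obtain ⟨c, hc, h⟩ := this (show θ ∈ Set.Icc _ _ from ⟨by simpa using h0, h1⟩)
  exact ⟨c, hc, h⟩

/-- The integral of `F` over the first coordinate, on the interval `[-R, R]`. -/
def marginal {n : ℕ} (R : ℝ) (F : (Fin (n + 1) → ℝ) → ℝ) (x : Fin n → ℝ) : ℝ :=
  ∫ t in (-R)..R, F (Fin.cons t x)

section Marginal

variable {n : ℕ} {R : ℝ} {F : (Fin (n + 1) → ℝ) → ℝ}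

lemma continuous_fiber (hF : Continuous F) (x : Fin n → ℝ) :
    Continuous fun t : ℝ => F (Fin.cons t x) :=
  hF.comp (continuous_cons.comp (by fun_prop : Continuous fun t : ℝ => (t, x)))

lemma continuous_primitive_fiber (hF : Continuous F) :
    Continuous fun p : (Fin n → ℝ) × ℝ => ∫ t in (-R)..p.2, F (Fin.cons t p.1) := by
  refine intervalIntegral.continuous_parametric_intervalIntegral_of_continuous (a₀ := -R)
    (f := fun (p : (Fin n → ℝ) × ℝ) t => F (Fin.cons t p.1)) ?_ continuous_snd
  exact hF.comp (continuous_cons.comp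
    (by fun_prop : Continuous fun q : ((Fin n → ℝ) × ℝ) × ℝ => (q.2, q.1.1)))

lemma continuous_marginal (hF : Continuous F) : Continuous (marginal R F) :=
  (continuous_primitive_fiber (R := R) hF).comp
    (by fun_prop : Continuous fun x : Fin n → ℝ => (x, R))

lemma ofReal_marginal (hR : 0 ≤ R) (hF : Continuous F) (hF0 : ∀ x, 0 ≤ F x) (x : Fin n → ℝ) :
    ENNReal.ofReal (marginal R F x) =
      ∫⁻ t in Set.Icc (-R) R, ENNReal.ofReal (F (Fin.cons t x)) := by
  rw [marginal, intervalIntegral.integral_of_le (by linarith), ← integral_Icc_eq_integral_Ioc,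
    ofReal_integral_eq_lintegral_ofReal]
  · exact ((continuous_fiber hF x).integrableOn_Icc)
  · exact Eventually.of_forall fun t => hF0 _

lemma lintegral_marginal (hR : 0 ≤ R) (hF : Continuous F) (hF0 : ∀ x, 0 ≤ F x) :
    ∫⁻ x in cube n R, ENNReal.ofReal (marginal R F x) =
      ∫⁻ x in cube (n + 1) R, ENNReal.ofReal (F x) := by
  rw [lintegral_cube_succ hF.measurable.ennreal_ofReal]
  simp only [ofReal_marginal hR hF hF0]

lemma marginal_nonneg (hR : 0 ≤ R) (hF0 : ∀ x, 0 ≤ F x) (x : Fin n → ℝ) : 0 ≤ marginal R F x :=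
  intervalIntegral.integral_nonneg (by linarith) fun _ _ => hF0 _

lemma marginal_pos (hR : 0 < R) (hF : Continuous F) (hF0 : ∀ x, 0 < F x) (x : Fin n → ℝ) :
    0 < marginal R F x :=
  intervalIntegral.intervalIntegral_pos_of_pos_on
    ((continuous_fiber hF x).intervalIntegrable _ _) (fun _ _ => hF0 _) (by linarith)

/-- Since F vanishes off the cube, the primitive is constant beyond ±R. The bound for every real t
lets the transport be defined, and differentiable, on whole lines. -/
lemma primitive_fiber_mem (hR : 0 ≤ R) (hF : Continuous F) (hF0 : ∀ x, 0 ≤ F x)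
    (hFs : ∀ x, x ∉ cube (n + 1) R → F x = 0) (x : Fin n → ℝ) (t : ℝ) :
    ∫ s in (-R)..t, F (Fin.cons s x) ∈ Set.Icc 0 (marginal R F x) := by
  have hi : ∀ a b, IntervalIntegrable (fun s => F (Fin.cons s x)) volume a b := fun a b =>
    (continuous_fiber hF x).intervalIntegrable _ _
  have hz : ∀ s, s ∉ Set.Icc (-R) R → F (Fin.cons s x) = 0 := fun s hs =>
    hFs _ fun h => hs (cons_mem_cube.1 h).1
  rcases le_or_gt (-R) t with h | h
  · refine ⟨intervalIntegral.integral_nonneg h fun _ _ => hF0 _, ?_⟩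
    rcases le_or_gt t R with h' | h'
    · rw [marginal, ← intervalIntegral.integral_add_adjacent_intervals (hi _ t) (hi t R)]
      exact le_add_of_nonneg_right (intervalIntegral.integral_nonneg h' fun _ _ => hF0 _)
    · rw [marginal, ← intervalIntegral.integral_add_adjacent_intervals (hi _ R) (hi R t)]
      rw [intervalIntegral.integral_zero_ae (a := R) (b := t), add_zero]
      refine Eventually.of_forall fun s hs => hz s fun h2 => ?_
      rw [Set.uIoc_of_le h'.le] at hs
      exact absurd h2.2 (not_le.2 hs.1)
  · rw [intervalIntegral.integral_symm, intervalIntegral.integral_zero_ae, neg_zero]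
    · exact ⟨le_rfl, marginal_nonneg hR hF0 x⟩
    · have hae : ∀ᵐ s : ℝ, s ≠ -R := Measure.ae_ne volume (-R)
      filter_upwards [hae] with s hs1 hs
      refine hz s fun h2 => ?_
      rw [Set.uIoc_of_le h.le] at hs
      exact hs1 (le_antisymm hs.2 h2.1)

/-- All primitives on the fibre are squeezed to 0; differentiating one recovers the continuous F. -/
lemma eq_zero_of_marginal_eq_zero (hR : 0 ≤ R) (hF : Continuous F) (hF0 : ∀ x, 0 ≤ F x)
    (hFs : ∀ x, x ∉ cube (n + 1) R → F x = 0) {x : Fin n → ℝ} (h : marginal R F x = 0) (t : ℝ) :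
    F (Fin.cons t x) = 0 := by
  have hc : ∀ t, ∫ s in (-R)..t, F (Fin.cons s x) = 0 := fun t => by
    have := primitive_fiber_mem hR hF hF0 hFs x t
    rw [h] at this
    exact le_antisymm this.2 this.1
  have h1 : HasDerivAt (fun t => ∫ s in (-R)..t, F (Fin.cons s x)) (F (Fin.cons t x)) t :=
    (continuous_fiber hF x).integral_hasStrictDerivAt _ _ |>.hasDerivAt
  simp only [hc] at h1
  exact h1.unique (hasDerivAt_const t 0)

end Marginal

/-- The last component of the Knothe map, given the map `T` of the remaining coordinates. -/
lemma exists_fiber_transport {n : ℕ} {R M : ℝ} (hR : 0 < R) (hM : 0 < M)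
    {F G : (Fin (n + 1) → ℝ) → ℝ} (hF : Continuous F) (hF0 : ∀ x, 0 ≤ F x)
    (hFs : ∀ x, x ∉ cube (n + 1) R → F x = 0) (hG : Continuous G) (hG0 : ∀ y, 0 < G y)
    {T : (Fin n → ℝ) → (Fin n → ℝ)} (hT : Measurable T) :
    ∃ S b : (Fin (n + 1) → ℝ) → ℝ, Measurable S ∧ Measurable b ∧ (∀ x, S x ∈ Set.Icc (-M) M) ∧
      (∀ x t, HasDerivAt (fun t => S (Fin.cons t x)) (b (Fin.cons t x)) t) ∧ (∀ x, 0 ≤ b x) ∧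
      (∀ x t, F (Fin.cons t x) * marginal M G (T x) =
        G (Fin.cons (S (Fin.cons t x)) (T x)) * b (Fin.cons t x) * marginal R F x) ∧
      (∀ x, marginal R F x ≠ 0 → S (Fin.cons (-R) x) = -M ∧ S (Fin.cons R x) = M) := by
  -- The mass of F up to t, rescaled to the total mass of the target fibre. On a fibre where F has
  -- no mass, division by zero gives θ = 0, so S is constantly -M there and remains differentiable.
  set θ : (Fin n → ℝ) → ℝ → ℝ := fun x t =>
    (∫ s in (-R)..t, F (Fin.cons s x)) * (marginal M G (T x) / marginal R F x) with hθ
  have hGpos := marginal_pos hM hG hG0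
  have hFnn := marginal_nonneg (n := n) hR.le hF0
  have hθmem : ∀ x t, θ x t ∈ Set.Icc 0 (marginal M G (T x)) := by
    intro x t
    have h := primitive_fiber_mem hR.le hF hF0 hFs x t
    refine ⟨mul_nonneg h.1 (div_nonneg (hGpos _).le (hFnn _)), ?_⟩
    rcases (hFnn x).eq_or_lt with h0 | h0
    · simp only [hθ, ← h0, div_zero, mul_zero]; exact (hGpos _).le
    · calc θ x t ≤ marginal R F x * (marginal M G (T x) / marginal R F x) :=
            mul_le_mul_of_nonneg_right h.2 (div_nonneg (hGpos _).le h0.le)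
        _ = _ := by field_simp
  have hex : ∀ x : Fin (n + 1) → ℝ, ∃ c ∈ Set.Icc (-M) M,
      ∫ s in (-M)..c, G (Fin.cons s (T (Fin.tail x))) = θ (Fin.tail x) (x 0) := fun x =>
    exists_integral_eq hM.le (continuous_fiber hG _) (hθmem _ _).1 (hθmem _ _).2
  choose S hSm hS using hex
  have hS' : ∀ x t, ∫ s in (-M)..S (Fin.cons t x), G (Fin.cons s (T x)) = θ x t := fun x t => by
    simpa using hS (Fin.cons t x)
  have hmono : ∀ y : Fin n → ℝ, StrictMono fun u => ∫ s in (-M)..u, G (Fin.cons s y) := fun y =>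
    strictMono_of_deriv_pos fun s => by
      rw [((continuous_fiber hG y).integral_hasStrictDerivAt _ _).hasDerivAt.deriv]
      exact hG0 _
  have hprim : Measurable fun x : Fin (n + 1) → ℝ =>
      ∫ s in (-R)..(x 0), F (Fin.cons s (Fin.tail x)) :=
    (continuous_primitive_fiber hF).measurable.comp
      (measurable_tail.prodMk (measurable_pi_apply 0))
  have hquot : Measurable fun x : Fin n → ℝ => marginal M G (T x) / marginal R F x :=
    ((continuous_marginal hG).measurable.comp hT).div (continuous_marginal hF).measurable
  have hSmeas : Measurable S := by
    refine measurable_of_Iic fun c => ?_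
    -- S is only given by choice; strict monotonicity of the target primitive turns its sublevel
    -- sets into inequalities between measurable functions.
    have : S ⁻¹' Set.Iic c = {x | θ (Fin.tail x) (x 0) ≤
        ∫ s in (-M)..c, G (Fin.cons s (T (Fin.tail x)))} := by
      ext x
      simp only [Set.mem_preimage, Set.mem_Iic, Set.mem_ofPred_eq, ← hS x]
      exact (hmono (T (Fin.tail x))).le_iff_le.symm
    rw [this]
    refine measurableSet_le (hprim.mul (hquot.comp measurable_tail)) ?_
    exact (continuous_primitive_fiber hG).measurable.comp
      ((hT.comp measurable_tail).prodMk measurable_const)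
  have htail : Measurable fun x : Fin (n + 1) → ℝ =>
      (Fin.cons (S x) (T (Fin.tail x)) : Fin (n + 1) → ℝ) :=
    measurable_cons.comp (hSmeas.prodMk (hT.comp measurable_tail))
  -- The derivative b is dictated by implicit differentiation: θ' divided by the target density at
  -- S.
  refine ⟨S, fun x => F x * (marginal M G (T (Fin.tail x)) / marginal R F (Fin.tail x)) /
    G (Fin.cons (S x) (T (Fin.tail x))), hSmeas, ?_, hSm, ?_, ?_, ?_, ?_⟩
  · exact (hF.measurable.mul (hquot.comp measurable_tail)).div (hG.measurable.comp htail)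
  · intro x t
    simp only [Fin.tail_cons]
    refine hasDerivAt_of_integral_eq (g := fun s => G (Fin.cons s (T x))) (θ := θ x)
      (S := fun t => S (Fin.cons t x)) (continuous_fiber hG _)
      (fun _ => hG0 _) (hS' x) ?_
    exact (((continuous_fiber hF x).integral_hasStrictDerivAt _ _).hasDerivAt).mul_const _
  · intro x
    exact div_nonneg (mul_nonneg (hF0 _) (div_nonneg (hGpos _).le (hFnn _))) (hG0 _).le
  · intro x t
    simp only [Fin.tail_cons]
    rcases eq_or_ne (marginal R F x) 0 with h0 | h0
    · rw [eq_zero_of_marginal_eq_zero hR.le hF hF0 hFs h0]; simp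
    · have := (hG0 (Fin.cons (S (Fin.cons t x)) (T x))).ne'
      field_simp
  · intro x hx
    refine ⟨(hmono (T x)).injective ?_, (hmono (T x)).injective ?_⟩
    · simp [hS', hθ]
    · simp only [hS', hθ]
      change marginal R F x * _ = marginal M G (T x)
      field_simp

/-- S may be constant where b vanishes, so injectivity is not available; monotonicity suffices for
the change of variables, and continuity makes the image the full interval. -/
lemma lintegral_image_Icc {S b : ℝ → ℝ} {c d : ℝ} (hS : ∀ t, HasDerivAt S (b t) t)
    (hb : ∀ t, 0 ≤ b t) (hcd : c ≤ d) (u : ℝ → ENNReal) :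
    ∫⁻ s in Set.Icc (S c) (S d), u s = ∫⁻ t in Set.Icc c d, ENNReal.ofReal (b t) * u (S t) := by
  have hmono : Monotone S := monotone_of_hasDerivAt_nonneg hS hb
  have hcont : Continuous S := continuous_iff_continuousAt.2 fun t => (hS t).continuousAt
  have him : S '' Set.Icc c d = Set.Icc (S c) (S d) := by
    refine Set.Subset.antisymm ?_ (intermediate_value_Icc hcd hcont.continuousOn)
    rintro _ ⟨t, ht, rfl⟩
    exact ⟨hmono ht.1, hmono ht.2⟩
  rw [← him]
  exact lintegral_image_eq_lintegral_deriv_mul_of_monotoneOn measurableSet_Icc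
    (fun t _ => (hS t).hasDerivWithinAt) (hmono.monotoneOn _) u

/-- The Knothe map between two densities on cubes, with its diagonal partial derivatives `a`. -/
structure IsKnotheMap {n : ℕ} (R M : ℝ) (F G : (Fin n → ℝ) → ℝ)
    (T : (Fin n → ℝ) → (Fin n → ℝ)) (a : Fin n → (Fin n → ℝ) → ℝ) : Prop where
  measurable : Measurable T
  measurable_deriv : ∀ i, Measurable (a i)
  mem_cube : ∀ x, T x ∈ cube n M
  hasDerivAt : ∀ x i t, HasDerivAt (fun t => T (Function.update x i t) i)
    (a i (Function.update x i t)) t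
  nonneg : ∀ i x, 0 ≤ a i x
  lintegral_comp : ∀ ψ : (Fin n → ℝ) → ENNReal, Measurable ψ →
    ∫⁻ x in cube n R, ψ (T x) * ENNReal.ofReal (F x) =
      ∫⁻ y in cube n M, ψ y * ENNReal.ofReal (G y)
  jacobian : ∀ x, F x = G (T x) * ∏ i, a i x
  lintegral_lt_top : ∀ i, ∫⁻ x in cube n R, ENNReal.ofReal (a i x) < ⊤

lemma volume_cube_lt_top (n : ℕ) (R : ℝ) : volume (cube n R) < ⊤ := (isCompact_cube n R).measure_lt_top

/-- Induction on the dimension: the marginals of F and G in the remaining coordinates are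
transported first, then the first coordinate is transported on each fibre. In dimension zero
equality of masses is F = G at the only point. Each a_i is integrable because T_i is monotone in x_i
with values in an interval of length 2M; this is what later permits integration by parts. -/
theorem exists_isKnotheMap {R M : ℝ} (hR : 0 < R) (hM : 0 < M) (n : ℕ) :
    ∀ {F G : (Fin n → ℝ) → ℝ}, Continuous F → (∀ x, 0 ≤ F x) →
      (∀ x, x ∉ cube n R → F x = 0) → Continuous G → (∀ y, 0 < G y) →
      ∫⁻ x in cube n R, ENNReal.ofReal (F x) = ∫⁻ y in cube n M, ENNReal.ofReal (G y) →
      ∃ T a, IsKnotheMap R M F G T a := by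
  induction n with
  | zero =>
    intro F G hF hF0 hFs hG hG0 hmass
    have hc : ∀ R : ℝ, cube 0 R = Set.univ := fun R => by
      ext x; simp [TalentiBubble.mem_cube]
    have hFG : ∀ x, F x = G x := by
      intro x
      rw [hc, hc, Measure.restrict_univ, volume_pi, Measure.pi_of_empty _ x,
        lintegral_dirac, lintegral_dirac] at hmass
      exact (ENNReal.ofReal_eq_ofReal_iff (hF0 x) (hG0 x).le).1 hmass
    refine ⟨id, fun _ _ => 0, measurable_id, fun i => i.elim0, fun x => by simp [hc],
      fun _ i => i.elim0, fun i => i.elim0, fun ψ _ => ?_, fun x => ?_, fun i => i.elim0⟩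
    · simp only [hc, id, hFG]
    · simp [hFG]
  | succ n ih =>
    intro F G hF hF0 hFs hG hG0 hmass
    have hG0' : ∀ y, 0 ≤ G y := fun y => (hG0 y).le
    obtain ⟨T, a, hK⟩ := ih (continuous_marginal (R := R) hF) (marginal_nonneg hR.le hF0)
      (fun x hx => by
        rw [marginal]
        have : ∀ t, F (Fin.cons t x) = 0 := fun t => hFs _ fun h => hx (cons_mem_cube.1 h).2
        simp [this])
      (continuous_marginal (R := M) hG) (marginal_pos hM hG hG0)
      (by rw [lintegral_marginal hR.le hF hF0, lintegral_marginal hM.le hG hG0', hmass])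
    obtain ⟨S, b, hSm, hbm, hSM, hSd, hb0, hjac, hend⟩ :=
      exists_fiber_transport hR hM hF hF0 hFs hG hG0 hK.measurable
    have hTmeas : Measurable fun x : Fin (n + 1) → ℝ =>
        (Fin.cons (S x) (T (Fin.tail x)) : Fin (n + 1) → ℝ) :=
      measurable_cons.comp (hSm.prodMk (hK.measurable.comp measurable_tail))
    refine ⟨fun x => Fin.cons (S x) (T (Fin.tail x)),
      fun i => Fin.cases b (fun j x => a j (Fin.tail x)) i, hTmeas, ?_, ?_, ?_, ?_, ?_, ?_, ?_⟩
    · intro i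
      refine Fin.cases hbm (fun j => ?_) i
      exact (hK.measurable_deriv j).comp measurable_tail
    · intro x
      exact cons_mem_cube.2 ⟨hSM _, hK.mem_cube _⟩
    · intro x i t
      refine Fin.cases ?_ (fun j => ?_) i
      · rw [← Fin.cons_self_tail x]
        simp only [Fin.update_cons_zero, Fin.cons_zero, Fin.cases_zero]
        exact hSd _ _
      · simp only [Fin.tail_update_succ, Fin.cons_succ, Fin.cases_succ]
        exact hK.hasDerivAt _ _ _
    · intro i x
      exact Fin.cases (hb0 x) (fun j => hK.nonneg j _) i
    · intro ψ hψ
      rw [lintegral_cube_succ (f := fun x => ψ (Fin.cons (S x) (T (Fin.tail x))) *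
          ENNReal.ofReal (F x)) ((hψ.comp hTmeas).mul hF.measurable.ennreal_ofReal),
        lintegral_cube_succ (f := fun y => ψ y * ENNReal.ofReal (G y)) (hψ.mul hG.measurable.ennreal_ofReal)]
      -- The conditional expectation of ψ under G given the remaining coordinates. Fibrewise
      -- transport replaces ψ by Ψ, to which the induction hypothesis for the marginals applies.
      set Ψ : (Fin n → ℝ) → ENNReal := fun y =>
        (∫⁻ s in Set.Icc (-M) M, ψ (Fin.cons s y) * ENNReal.ofReal (G (Fin.cons s y))) /
          ENNReal.ofReal (marginal M G y) with hΨ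
      have hgm : ∀ y, ENNReal.ofReal (marginal M G y) ≠ 0 := fun y => by
        simpa using marginal_pos hM hG hG0 y
      have hΨm : Measurable Ψ := by
        refine Measurable.div ?_ (continuous_marginal hG).measurable.ennreal_ofReal
        refine Measurable.lintegral_prod_right' (f := fun p : (Fin n → ℝ) × ℝ =>
          ψ (Fin.cons p.2 p.1) * ENNReal.ofReal (G (Fin.cons p.2 p.1))) ?_
        exact (hψ.mul hG.measurable.ennreal_ofReal).comp
          (measurable_cons.comp measurable_swap)
      have h1 : ∀ x, ∫⁻ t in Set.Icc (-R) R,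
          ψ (Fin.cons (S (Fin.cons t x)) (T (Fin.tail (Fin.cons t x : Fin (n + 1) → ℝ)))) *
            ENNReal.ofReal (F (Fin.cons t x)) =
          Ψ (T x) * ENNReal.ofReal (marginal R F x) := by
        intro x
        simp only [Fin.tail_cons]
        rcases eq_or_ne (marginal R F x) 0 with h0 | h0
        · simp [eq_zero_of_marginal_eq_zero hR.le hF hF0 hFs h0, h0]
        · have h2 := lintegral_image_Icc (hSd x) (fun t => hb0 _) (by linarith : -R ≤ R)
            (fun s => ψ (Fin.cons s (T x)) * ENNReal.ofReal (G (Fin.cons s (T x))))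
          rw [(hend x h0).1, (hend x h0).2] at h2
          simp only [hΨ]
          rw [h2, ENNReal.div_eq_inv_mul, mul_assoc, mul_comm _ (ENNReal.ofReal (marginal R F x)),
            ← lintegral_const_mul' _ _ ENNReal.ofReal_ne_top,
            ← lintegral_const_mul' _ _ (ENNReal.inv_ne_top.2 (hgm _))]
          refine lintegral_congr fun t => ?_
          have h3 := congrArg ENNReal.ofReal (hjac x t)
          rw [ENNReal.ofReal_mul (hF0 _), ENNReal.ofReal_mul (mul_nonneg (hG0' _) (hb0 _)),
            ENNReal.ofReal_mul (hG0' _)] at h3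
          have h4 : ENNReal.ofReal (F (Fin.cons t x)) = (ENNReal.ofReal (marginal M G (T x)))⁻¹ *
              (ENNReal.ofReal (F (Fin.cons t x)) * ENNReal.ofReal (marginal M G (T x))) := by
            rw [mul_comm (ENNReal.ofReal (F _)), ← mul_assoc,
              ENNReal.inv_mul_cancel (hgm _) ENNReal.ofReal_ne_top, one_mul]
          rw [h4, h3]
          ring
      simp only [h1]
      rw [hK.lintegral_comp Ψ hΨm]
      refine lintegral_congr fun y => ?_
      simp only [hΨ]
      rw [ENNReal.div_mul_cancel (hgm _) ENNReal.ofReal_ne_top]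
    · intro x
      rw [Fin.prod_univ_succ]
      simp only [Fin.cases_zero, Fin.cases_succ]
      obtain ⟨t, x, rfl⟩ : ∃ (t : ℝ) (x' : Fin n → ℝ), x = Fin.cons t x' :=
        ⟨x 0, Fin.tail x, (Fin.cons_self_tail x).symm⟩
      simp only [Fin.tail_cons]
      have h := hjac x t
      have h2 := hK.jacobian x
      have h3 := (marginal_pos hM hG hG0 (T x)).ne'
      -- Multiplying by the marginal of G at T x lets the fibre identity and the Jacobian identity
      -- of the marginals be chained without dividing by the marginal of F, which may vanish.
      refine mul_right_cancel₀ h3 ?_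
      rw [h, h2]
      ring
    · intro i
      refine Fin.cases ?_ (fun j => ?_) i
      · simp only [Fin.cases_zero]
        rw [lintegral_cube_succ hbm.ennreal_ofReal]
        -- On each fibre the integral of b is the increment of S from -R to R.
        calc ∫⁻ x in cube n R, ∫⁻ t in Set.Icc (-R) R, ENNReal.ofReal (b (Fin.cons t x))
            ≤ ∫⁻ x in cube n R, ENNReal.ofReal (2 * M) := by
              refine lintegral_mono fun x => ?_
              have h2 := lintegral_image_Icc (hSd x) (fun t => hb0 _) (by linarith : -R ≤ R) 1
              simp only [Pi.one_apply, mul_one, lintegral_one, Measure.restrict_apply_univ,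
                Real.volume_Icc] at h2
              rw [← h2]
              refine ENNReal.ofReal_le_ofReal ?_
              linarith [(hSM (Fin.cons R x)).2, (hSM (Fin.cons (-R) x)).1]
          _ < ⊤ := by
              rw [setLIntegral_const]
              exact ENNReal.mul_lt_top ENNReal.ofReal_lt_top (volume_cube_lt_top n R)
      · simp only [Fin.cases_succ]
        rw [lintegral_cube_succ (f := fun x => ENNReal.ofReal (a j (Fin.tail x)))
          ((hK.measurable_deriv j).comp measurable_tail).ennreal_ofReal]
        simp only [Fin.tail_cons, setLIntegral_const]
        rw [lintegral_mul_const' _ _ measure_Icc_lt_top.ne]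
        exact ENNReal.mul_lt_top (hK.lintegral_lt_top j) measure_Icc_lt_top

/-! ### The sharp Sobolev inequality by transport -/

namespace IsKnotheMap

variable {n : ℕ} {R M : ℝ} {F G : (Fin n → ℝ) → ℝ} {T : (Fin n → ℝ) → (Fin n → ℝ)}
  {a : Fin n → (Fin n → ℝ) → ℝ}

lemma hasLineDerivAt (hK : IsKnotheMap R M F G T a) (i : Fin n) (x : Fin n → ℝ) :
    HasLineDerivAt ℝ (fun x => T x i) (a i x) x (Pi.single i 1) := by
  have h := hK.hasDerivAt x i (x i)
  rw [Function.update_eq_self] at h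
  have h2 : HasDerivAt (fun t : ℝ => x i + t) 1 0 := by
    simpa using (hasDerivAt_id (0 : ℝ)).const_add (x i)
  have h3 : HasDerivAt (fun t => T (Function.update x i t) i) (a i x) (x i + 0) := by
    simpa using h
  have h4 := h3.comp (0 : ℝ) h2
  rw [mul_one] at h4
  refine h4.congr_of_eventuallyEq (Eventually.of_forall fun t => ?_)
  have : x + t • Pi.single i (1 : ℝ) = Function.update x i (x i + t) := by
    ext j
    rcases eq_or_ne j i with rfl | h
    · simp
    · simp [h]
  simp [this]

lemma abs_le (hK : IsKnotheMap R M F G T a) (x : Fin n → ℝ) (i : Fin n) : |T x i| ≤ M :=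
  _root_.abs_le.2 (TalentiBubble.mem_cube.1 (hK.mem_cube x) i)

lemma integrableOn_deriv (hK : IsKnotheMap R M F G T a) (i : Fin n) :
    IntegrableOn (a i) (cube n R) := by
  refine ⟨(hK.measurable_deriv i).aestronglyMeasurable, ?_⟩
  rw [hasFiniteIntegral_iff_ofReal (Eventually.of_forall (hK.nonneg i))]
  exact hK.lintegral_lt_top i

/-- Arithmetic-geometric mean inequality for the a_i, whose product is F/G(T). It plays the role of
det(DT)^{1/n} ≤ div(T)/n. -/
lemma rpow_mul_le (hK : IsKnotheMap R M F G T a) (hn : 0 < n) (hF0 : ∀ x, 0 ≤ F x)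
    (hG0 : ∀ y, 0 < G y) (x : Fin n → ℝ) :
    G (T x) ^ (-(1 / n : ℝ)) * F x ≤ F x ^ (1 - 1 / n : ℝ) * ((1 / n : ℝ) * ∑ i, a i x) := by
  have hn' : (0 : ℝ) < n := by exact_mod_cast hn
  have hsum : 0 ≤ ∑ i, a i x := Finset.sum_nonneg fun i _ => hK.nonneg i x
  rcases (hF0 x).eq_or_lt with h0 | h0
  · rw [← h0, mul_zero]
    have := Real.rpow_nonneg (le_refl (0 : ℝ)) (1 - 1 / n : ℝ)
    positivity
  · have hAG := Real.geom_mean_le_arith_mean_weighted Finset.univ (fun _ : Fin n => (1 / n : ℝ))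
      (fun i => a i x) (fun _ _ => by positivity) (by simp [hn'.ne']) (fun i _ => hK.nonneg i x)
    rw [← Finset.mul_sum, Real.finsetProd_rpow _ _ fun i _ => hK.nonneg i x] at hAG
    have hprod : ∏ i, a i x = F x / G (T x) := by
      rw [hK.jacobian x, mul_div_cancel_left₀ _ (hG0 _).ne']
    rw [hprod, Real.div_rpow h0.le (hG0 _).le] at hAG
    calc G (T x) ^ (-(1 / n : ℝ)) * F x
        = F x ^ (1 - 1 / n : ℝ) * (F x ^ (1 / n : ℝ) / G (T x) ^ (1 / n : ℝ)) := by
          rw [Real.rpow_neg (hG0 _).le, Real.rpow_sub h0, Real.rpow_one]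
          have := (Real.rpow_pos_of_pos h0 (1 / n : ℝ)).ne'
          have := (Real.rpow_pos_of_pos (hG0 (T x)) (1 / n : ℝ)).ne'
          field_simp
      _ ≤ _ := mul_le_mul_of_nonneg_left hAG (Real.rpow_nonneg h0.le _)

/-- Pull back G^{-1/n} · G by T, apply `rpow_mul_le`, and move each ∂_i from T_i to P. Since P and
its partial derivatives vanish off the cube, there is no boundary term, and boundedness of T with
integrability of a_i suffices. -/
lemma integral_rpow_le (hK : IsKnotheMap R M F G T a) (hn : 0 < n) (hF0 : ∀ x, 0 ≤ F x)
    (hG : Continuous G) (hG0 : ∀ y, 0 < G y) {P : (Fin n → ℝ) → ℝ}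
    {p : Fin n → (Fin n → ℝ) → ℝ} (hP : Continuous P) (hPF : ∀ x, P x = F x ^ (1 - 1 / n : ℝ))
    (hPs : ∀ x, x ∉ cube n R → P x = 0) (hp : ∀ i, Continuous (p i))
    (hps : ∀ i x, x ∉ cube n R → p i x = 0)
    (hd : ∀ i x, HasLineDerivAt ℝ P (p i x) x (Pi.single i 1)) :
    ∫ y in cube n M, G y ^ (1 - 1 / n : ℝ) ≤ (1 / n : ℝ) * ∫ x, -∑ i, p i x * T x i := by
  have hn' : (0 : ℝ) < n := by exact_mod_cast hn
  have hP0 : ∀ x, 0 ≤ P x := fun x => by rw [hPF]; exact Real.rpow_nonneg (hF0 x) _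
  have hT : ∀ i, Measurable fun x => T x i := fun i => (measurable_pi_apply i).comp hK.measurable
  have hcube := (isCompact_cube n R)
  have hPa : ∀ i, Integrable fun x => P x * a i x := fun i => by
    rw [← integrableOn_iff_integrable_of_support_subset (s := cube n R)]
    · exact (hK.integrableOn_deriv i).continuousOn_mul hP.continuousOn hcube
    · intro x hx
      by_contra h
      exact hx (by simp [hPs x h])
  have hmulT : ∀ (f : (Fin n → ℝ) → ℝ) i, Continuous f → (∀ x, x ∉ cube n R → f x = 0) →
      Integrable fun x => f x * T x i := fun f i hf hfs => by
    rw [← integrableOn_iff_integrable_of_support_subset (s := cube n R)]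
    · refine IntegrableOn.continuousOn_mul hf.continuousOn ?_ hcube
      refine Measure.integrableOn_of_bounded (M := M) (volume_cube_lt_top n R).ne
        (hT i).aestronglyMeasurable (Eventually.of_forall fun x => hK.abs_le x i)
    · intro x hx
      by_contra h
      exact hx (by simp [hfs x h])
  have hparts : ∀ i, ∫ x, P x * a i x = -∫ x, p i x * T x i := fun i => by
    have := integral_bilinear_hasLineDerivAt_right_eq_neg_left_of_integrable
      (μ := (volume : Measure (Fin n → ℝ))) (f := P) (f' := p i) (g := fun x => T x i) (g' := a i)
      (v := Pi.single i 1) (B := ContinuousLinearMap.mul ℝ ℝ)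
      (by simpa using hmulT _ i (hp i) (hps i)) (by simpa using hPa i)
      (by simpa using hmulT _ i hP hPs) (fun x _ => hd i x) (fun x _ => hK.hasLineDerivAt i x)
    simpa using this
  have hrhs : (1 / n : ℝ) * ∫ x, -∑ i, p i x * T x i =
      ∫ x, P x * ((1 / n : ℝ) * ∑ i, a i x) := by
    rw [integral_neg, integral_finsetSum _ fun i _ => hmulT _ i (hp i) (hps i),
      ← Finset.sum_neg_distrib]
    simp only [← hparts]
    rw [← integral_finsetSum _ fun i _ => hPa i, ← integral_const_mul]
    refine integral_congr_ae (Eventually.of_forall fun x => ?_)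
    simp only [← Finset.mul_sum]
    ring
  have hint : Integrable fun x => P x * ((1 / n : ℝ) * ∑ i, a i x) := by
    have := (integrable_finsetSum Finset.univ fun i _ => hPa i).const_mul (1 / n : ℝ)
    refine this.congr (Eventually.of_forall fun x => ?_)
    simp only [← Finset.mul_sum]
    ring
  have hnn : ∀ x, 0 ≤ P x * ((1 / n : ℝ) * ∑ i, a i x) := fun x =>
    mul_nonneg (hP0 x) (mul_nonneg (by positivity) (Finset.sum_nonneg fun i _ => hK.nonneg i x))
  have hGr : ∀ r : ℝ, Continuous fun y => G y ^ r := fun r =>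
    hG.rpow_const fun y => Or.inl (hG0 y).ne'
  -- In `ENNReal` the transport identity holds for all measurable integrands, so the pulled-back
  -- integrand needs no integrability check.
  rw [hrhs, ← ENNReal.ofReal_le_ofReal_iff (integral_nonneg hnn),
    ofReal_integral_eq_lintegral_ofReal ((hGr _).continuousOn.integrableOn_compact
      (isCompact_cube n M)) (Eventually.of_forall fun y => Real.rpow_nonneg (hG0 y).le _),
    ofReal_integral_eq_lintegral_ofReal hint (Eventually.of_forall hnn)]
  calc ∫⁻ y in cube n M, ENNReal.ofReal (G y ^ (1 - 1 / n : ℝ))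
      = ∫⁻ y in cube n M, ENNReal.ofReal (G y ^ (-(1 / n) : ℝ)) * ENNReal.ofReal (G y) := by
        refine lintegral_congr fun y => ?_
        rw [← ENNReal.ofReal_mul (Real.rpow_nonneg (hG0 y).le _), sub_eq_neg_add,
          Real.rpow_add (hG0 y), Real.rpow_one]
    _ = ∫⁻ x in cube n R, ENNReal.ofReal (G (T x) ^ (-(1 / n) : ℝ)) * ENNReal.ofReal (F x) :=
        (hK.lintegral_comp _ (hGr _).measurable.ennreal_ofReal).symm
    _ ≤ ∫⁻ x in cube n R, ENNReal.ofReal (P x * ((1 / n : ℝ) * ∑ i, a i x)) := by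
        refine lintegral_mono fun x => ?_
        simp only
        rw [← ENNReal.ofReal_mul (Real.rpow_nonneg (hG0 _).le _), hPF]
        exact ENNReal.ofReal_le_ofReal (hK.rpow_mul_le hn hF0 hG0 x)
    _ ≤ _ := setLIntegral_le_lintegral _ _

end IsKnotheMap

lemma exists_subset_cube {n : ℕ} {K : Set (Fin n → ℝ)} (hK : IsCompact K) :
    ∃ R : ℝ, 0 < R ∧ K ⊆ cube n R := by
  obtain ⟨R, hR⟩ := hK.isBounded.exists_norm_le
  refine ⟨max R 1, by positivity, fun x hx => mem_cube.2 fun i => abs_le.1 ?_⟩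
  exact ((norm_le_pi_norm x i).trans (hR x hx)).trans (le_max_left _ _)

lemma integral_mul_le_sqrt_mul_sqrt {α : Type*} [MeasurableSpace α] {μ : Measure α} {f g : α → ℝ}
    (hf0 : ∀ x, 0 ≤ f x) (hg0 : ∀ x, 0 ≤ g x) (hf : MemLp f 2 μ) (hg : MemLp g 2 μ) :
    ∫ x, f x * g x ∂μ ≤ √(∫ x, f x ^ 2 ∂μ) * √(∫ x, g x ^ 2 ∂μ) := by
  have h := integral_mul_le_Lp_mul_Lq_of_nonneg (μ := μ) (f := f) (g := g) (p := 2) (q := 2)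
    Real.HolderConjugate.two_two (Eventually.of_forall hf0) (Eventually.of_forall hg0)
    (by simpa using hf) (by simpa using hg)
  simpa [Real.sqrt_eq_rpow] using h

lemma IsKnotheMap.integral_comp {n : ℕ} {R M : ℝ} {F G : (Fin n → ℝ) → ℝ}
    {T : (Fin n → ℝ) → (Fin n → ℝ)} {a : Fin n → (Fin n → ℝ) → ℝ} (hK : IsKnotheMap R M F G T a)
    (hF : Continuous F) (hF0 : ∀ x, 0 ≤ F x) (hFs : ∀ x, x ∉ cube n R → F x = 0)
    (hG : Continuous G) (hG0 : ∀ y, 0 ≤ G y) {ψ : (Fin n → ℝ) → ℝ} (hψ : Continuous ψ)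
    (hψ0 : ∀ y, 0 ≤ ψ y) :
    ∫ x, ψ (T x) * F x = ∫ y in cube n M, ψ y * G y := by
  have h1 : ∫ x, ψ (T x) * F x = ∫ x in cube n R, ψ (T x) * F x := by
    rw [setIntegral_eq_integral_of_forall_compl_eq_zero]
    intro x hx
    rw [hFs x hx, mul_zero]
  rw [h1, integral_eq_lintegral_of_nonneg_ae
    (Eventually.of_forall fun x => mul_nonneg (hψ0 _) (hF0 _))
    ((hψ.measurable.comp hK.measurable).mul hF.measurable).aestronglyMeasurable,
    integral_eq_lintegral_of_nonneg_ae
    (Eventually.of_forall fun x => mul_nonneg (hψ0 _) (hG0 _))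
    (hψ.mul hG).aestronglyMeasurable]
  congr 1
  simp only [ENNReal.ofReal_mul (hψ0 _)]
  exact hK.lintegral_comp _ hψ.measurable.ennreal_ofReal

lemma critExp_pos {n : ℕ} (hn : 3 ≤ n) : 0 < critExp n := by
  have : (3 : ℝ) ≤ n := by exact_mod_cast hn
  unfold critExp
  exact div_pos (by linarith) (by linarith)

/-- The transport inequality for a test function and a target density on a cube. -/
theorem integral_cube_rpow_le {n : ℕ} (hn : 3 ≤ n) {φ : (Fin n → ℝ) → ℝ} (hφ : ContDiff ℝ 1 φ)
    (hc : HasCompactSupport φ) {G : (Fin n → ℝ) → ℝ} (hG : Continuous G) (hG0 : ∀ y, 0 < G y)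
    {M : ℝ} (hM : 0 < M) (hA : 0 < ∫ x, |φ x| ^ critExp n) :
    ∫ y in cube n M, G y ^ (1 - 1 / n : ℝ) ≤
      (2 * (n - 1) / (n * (n - 2)) : ℝ) *
        ((∫ y in cube n M, G y) / ∫ x, |φ x| ^ critExp n) ^ (1 / 2 - 1 / n : ℝ) *
        (√(∫ x, ∑ i, (fderiv ℝ φ x (Pi.single i 1)) ^ 2) *
          √(∫ y in cube n M, (∑ i, y i ^ 2) * G y)) := by
  have hn3 : (3 : ℝ) ≤ n := by exact_mod_cast hn
  have hn2 : (0 : ℝ) < n - 2 := by linarith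
  set m := critExp n with hm
  have hm0 : 0 < m := critExp_pos hn
  -- F^{1-1/n} is a multiple of |φ|^s. The relation s - 1 = m/2 makes the factor |φ|^{s-1}|T| square
  -- integrable with square |φ|^m|T|², and s > 2 keeps the derivative factor |φ|^{s-2} continuous.
  set s : ℝ := 2 * (n - 1) / (n - 2) with hs
  have hms : m * (1 - 1 / n : ℝ) = s := by
    rw [hm, hs, critExp]; field_simp
  have hsm : s - 1 = m / 2 := by
    rw [hm, hs, critExp]; field_simp; ring
  have hm2 : 2 < m := by
    rw [hm, critExp, lt_div_iff₀ hn2]; linarith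
  have hs2 : 0 < s - 2 := by linarith
  obtain ⟨R, hR, hsub⟩ := exists_subset_cube (K := tsupport φ) hc
  have hφs : ∀ x, x ∉ cube n R → φ x = 0 := fun x hx =>
    image_eq_zero_of_notMem_tsupport fun h => hx (hsub h)
  set A := ∫ x, |φ x| ^ m with hAdef
  set B := ∫ y in cube n M, G y with hBdef
  have hcube : volume (cube n M) ≠ 0 := by
    rw [cube, volume_pi_pi]
    exact Finset.prod_ne_zero_iff.2 fun i _ => by simp [hM]
  have hGi : IntegrableOn G (cube n M) := hG.continuousOn.integrableOn_compact (isCompact_cube n M)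
  have hB : 0 < B := by
    rw [hBdef, setIntegral_pos_iff_support_of_nonneg_ae
      (Eventually.of_forall fun y => (hG0 y).le) hGi]
    have : Function.support G = Set.univ := Set.eq_univ_of_forall fun y => (hG0 y).ne'
    rw [this, Set.univ_inter]
    exact pos_iff_ne_zero.2 hcube
  -- The factor equalising the masses of F and G.
  set l := B / A with hl
  have hl0 : 0 < l := div_pos hB hA
  have hφm : Continuous fun x => |φ x| ^ m :=
    hφ.continuous.abs.rpow_const fun _ => Or.inr hm0.le
  have hφmi : Integrable fun x => |φ x| ^ m := by
    refine hφm.integrable_of_hasCompactSupport (hc.mono' ?_)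
    refine fun x hx => subset_tsupport _ fun h => hx ?_
    simp [h, hm0.ne']
  set F : (Fin n → ℝ) → ℝ := fun x => l * |φ x| ^ m with hFdef
  have hF : Continuous F := hφm.const_mul l
  have hF0 : ∀ x, 0 ≤ F x := fun x => mul_nonneg hl0.le (Real.rpow_nonneg (abs_nonneg _) _)
  have hFs : ∀ x, x ∉ cube n R → F x = 0 := fun x hx => by
    simp [hFdef, hφs x hx, hm0.ne']
  have hmass : ∫⁻ x in cube n R, ENNReal.ofReal (F x) =
      ∫⁻ y in cube n M, ENNReal.ofReal (G y) := by
    rw [← ofReal_integral_eq_lintegral_ofReal (hφmi.const_mul l).integrableOn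
      (Eventually.of_forall hF0),
      ← ofReal_integral_eq_lintegral_ofReal hGi (Eventually.of_forall fun y => (hG0 y).le)]
    congr 1
    rw [setIntegral_eq_integral_of_forall_compl_eq_zero hFs, integral_const_mul, hl, ← hAdef,
      div_mul_cancel₀ _ hA.ne']
  obtain ⟨T, a, hK⟩ := exists_isKnotheMap hR hM n hF hF0 hFs hG hG0 hmass
  set k : ℝ := l ^ (1 - 1 / n : ℝ) with hk
  have hk0 : 0 < k := Real.rpow_pos_of_pos hl0 _
  set d : Fin n → (Fin n → ℝ) → ℝ := fun i x => fderiv ℝ φ x (Pi.single i 1) with hd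
  have hdc : ∀ i, Continuous (d i) := fun i =>
    (hφ.continuous_fderiv one_ne_zero).clm_apply continuous_const
  have hds : ∀ i x, x ∉ cube n R → d i x = 0 := fun i x hx => by
    have : fderiv ℝ φ x = 0 :=
      image_eq_zero_of_notMem_tsupport fun h => hx (hsub (tsupport_fderiv_subset ℝ h))
    simp [hd, this]
  have key := hK.integral_rpow_le (by omega) hF0 hG hG0
    (P := fun x => k * |φ x| ^ s)
    (p := fun i x => k * (s * |φ x| ^ (s - 2) * φ x * d i x))
    ((hφ.continuous.abs.rpow_const fun _ => Or.inr (by linarith)).const_mul k)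
    (fun x => by
      rw [hFdef, Real.mul_rpow hl0.le (Real.rpow_nonneg (abs_nonneg _) _),
        ← Real.rpow_mul (abs_nonneg _), hms])
    (fun x hx => by
      have : s ≠ 0 := by linarith
      simp [hφs x hx, this])
    (fun i => ((((hφ.continuous.abs.rpow_const fun _ => Or.inr hs2.le).const_mul s).mul
      hφ.continuous).mul (hdc i)).const_mul k)
    (fun i x hx => by simp [hφs x hx])
    (fun i x => by
      have h1 : HasFDerivAt φ (fderiv ℝ φ x) x :=
        ((hφ.differentiable one_ne_zero) x).hasFDerivAt
      have h2 := hasDerivAt_abs_rpow (φ x) (p := s) (by linarith)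
      have h3 := ((h2.comp_hasFDerivAt x h1).const_mul k).hasLineDerivAt (Pi.single i 1)
      simpa [hd, mul_assoc] using h3)
  have hTm : ∀ i, Measurable fun x => T x i := fun i => (measurable_pi_apply i).comp hK.measurable
  have hsqd : Continuous fun x => √(∑ i, d i x ^ 2) :=
    (continuous_finsetSum _ fun i _ => (hdc i).pow 2).sqrt
  set V : (Fin n → ℝ) → ℝ := fun x => |φ x| ^ (m / 2) * √(∑ i, T x i ^ 2) with hV
  have hVsq : ∀ x, V x ^ 2 = |φ x| ^ m * ∑ i, T x i ^ 2 := fun x => by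
    rw [hV, mul_pow, Real.sq_sqrt (Finset.sum_nonneg fun i _ => sq_nonneg _), ← Real.rpow_natCast,
      ← Real.rpow_mul (abs_nonneg _)]
    norm_num
  have hVm : Measurable V :=
    (hφ.continuous.abs.rpow_const fun _ => Or.inr (by positivity)).measurable.mul
      (Finset.measurable_fun_sum _ fun i _ => (hTm i).pow_const 2).sqrt
  have hV2 : MemLp V 2 := by
    rw [memLp_two_iff_integrable_sq hVm.aestronglyMeasurable]
    simp only [hVsq]
    refine hφmi.mul_bdd (c := ∑ _i : Fin n, M ^ 2)
      (Finset.measurable_fun_sum _ fun i _ => (hTm i).pow_const 2).aestronglyMeasurable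
      (Eventually.of_forall fun x => ?_)
    rw [Real.norm_of_nonneg (Finset.sum_nonneg fun i _ => sq_nonneg _)]
    exact Finset.sum_le_sum fun i _ => sq_le_sq' (abs_le.1 (hK.abs_le x i)).1
      (abs_le.1 (hK.abs_le x i)).2
  have hD2 : MemLp (fun x => √(∑ i, d i x ^ 2)) 2 := by
    refine hsqd.memLp_of_hasCompactSupport (HasCompactSupport.intro (isCompact_cube n R) ?_)
    intro x hx
    simp [hds _ x hx]
  have hCS := integral_mul_le_sqrt_mul_sqrt (μ := volume) (fun x => Real.sqrt_nonneg (∑ i, d i x ^ 2))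
    (fun x => mul_nonneg (Real.rpow_nonneg (abs_nonneg (φ x)) (m / 2))
      (Real.sqrt_nonneg (∑ i, T x i ^ 2))) hD2 hV2
  have hcomp := hK.integral_comp hF hF0 hFs hG (fun y => (hG0 y).le)
    (ψ := fun y => ∑ i, y i ^ 2) (by fun_prop) (fun y => Finset.sum_nonneg fun i _ => sq_nonneg _)
  set Q := ∫ y in cube n M, (∑ i, y i ^ 2) * G y with hQ
  -- The square of V is l⁻¹|T|²F, so the transport turns its integral into the second moment of G.
  have hVint : ∫ x, V x ^ 2 = l⁻¹ * Q := by
    rw [← hcomp, ← integral_const_mul]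
    refine integral_congr_ae (Eventually.of_forall fun x => ?_)
    simp only [hVsq, hFdef]
    field_simp
  have hDint : ∫ x, √(∑ i, d i x ^ 2) ^ 2 = ∫ x, ∑ i, d i x ^ 2 :=
    integral_congr_ae (Eventually.of_forall fun x =>
      Real.sq_sqrt (Finset.sum_nonneg fun i _ => sq_nonneg _))
  rw [hDint] at hCS
  change ∫ x, √(∑ i, d i x ^ 2) * V x ≤ _ * √(∫ x, V x ^ 2) at hCS
  rw [hVint, Real.sqrt_mul (inv_nonneg.2 hl0.le)] at hCS
  have hpt : ∀ x, -∑ i, k * (s * |φ x| ^ (s - 2) * φ x * d i x) * T x i ≤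
      k * s * (√(∑ i, d i x ^ 2) * V x) := by
    intro x
    have h1 : -∑ i, k * (s * |φ x| ^ (s - 2) * φ x * d i x) * T x i =
        k * s * (|φ x| ^ (s - 2) * (-φ x * ∑ i, d i x * T x i)) := by
      simp only [Finset.mul_sum, ← Finset.sum_neg_distrib]
      refine Finset.sum_congr rfl fun i _ => ?_
      ring
    have h2 : |∑ i, d i x * T x i| ≤ √(∑ i, d i x ^ 2) * √(∑ i, T x i ^ 2) := by
      refine abs_le_of_sq_le_sq ?_ (by positivity)
      rw [mul_pow, Real.sq_sqrt (Finset.sum_nonneg fun i _ => sq_nonneg _),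
        Real.sq_sqrt (Finset.sum_nonneg fun i _ => sq_nonneg _)]
      exact Finset.sum_mul_sq_le_sq_mul_sq _ _ _
    have h3 : -φ x * ∑ i, d i x * T x i ≤ |φ x| * (√(∑ i, d i x ^ 2) * √(∑ i, T x i ^ 2)) :=
      calc -φ x * ∑ i, d i x * T x i ≤ |-φ x * ∑ i, d i x * T x i| := le_abs_self _
        _ = |φ x| * |∑ i, d i x * T x i| := by rw [abs_mul, abs_neg]
        _ ≤ _ := mul_le_mul_of_nonneg_left h2 (abs_nonneg _)
    have h4 : |φ x| ^ (m / 2) = |φ x| ^ (s - 2) * |φ x| := by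
      rw [← hsm]
      conv_rhs => rw [← Real.rpow_one |φ x|, ← Real.rpow_mul (abs_nonneg _), one_mul]
      rw [← Real.rpow_add_of_nonneg (abs_nonneg _) hs2.le zero_le_one]
      ring_nf
    rw [h1, hV]
    refine mul_le_mul_of_nonneg_left ?_ (mul_nonneg hk0.le (by linarith))
    simp only [h4]
    calc _ ≤ |φ x| ^ (s - 2) * (|φ x| * (√(∑ i, d i x ^ 2) * √(∑ i, T x i ^ 2))) :=
          mul_le_mul_of_nonneg_left h3 (Real.rpow_nonneg (abs_nonneg _) _)
      _ = _ := by ring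
  have hint1 : Integrable fun x => √(∑ i, d i x ^ 2) * V x := hD2.integrable_mul hV2
  have hint0 : Integrable fun x => -∑ i, k * (s * |φ x| ^ (s - 2) * φ x * d i x) * T x i := by
    refine (integrable_finsetSum _ fun i _ => ?_).neg
    refine Integrable.mul_bdd (c := M) ?_ (hTm i).aestronglyMeasurable
      (Eventually.of_forall fun x => hK.abs_le x i)
    refine Continuous.integrable_of_hasCompactSupport ?_
      (HasCompactSupport.intro (isCompact_cube n R) ?_)
    · exact ((((hφ.continuous.abs.rpow_const fun _ => Or.inr hs2.le).const_mul s).mul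
        hφ.continuous).mul (hdc i)).const_mul k
    · intro x hx
      simp [hds i x hx]
  have hint2 := integral_mono hint0 (hint1.const_mul (k * s)) hpt
  rw [integral_const_mul] at hint2
  have hkl : k * √l⁻¹ = l ^ (1 / 2 - 1 / n : ℝ) := by
    rw [hk, Real.sqrt_eq_rpow, Real.inv_rpow hl0.le, ← Real.rpow_neg hl0.le, ← Real.rpow_add hl0]
    ring_nf
  calc _ ≤ _ := key
    _ ≤ (1 / n : ℝ) * (k * s * (√(∫ x, ∑ i, d i x ^ 2) * (√l⁻¹ * √Q))) := by
        refine mul_le_mul_of_nonneg_left (hint2.trans ?_) (by positivity)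
        exact mul_le_mul_of_nonneg_left hCS (mul_nonneg hk0.le (by linarith))
    _ = (2 * (n - 1) / (n * (n - 2)) : ℝ) * (k * √l⁻¹) * (√(∫ x, ∑ i, d i x ^ 2) * √Q) := by
        rw [hs]; field_simp
    _ = _ := by rw [hkl]

/-! ### Integrals of bubbles -/

variable {N : ℕ}

lemma three_le_cast (hN : 3 ≤ N) : (3 : ℝ) ≤ N := by exact_mod_cast hN

lemma nontrivial_of_three_le (hN : 3 ≤ N) : Nontrivial (E N) :=
  Module.nontrivial_of_finrank_pos (R := ℝ) (by rw [finrank_euclideanSpace_fin]; omega)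

lemma sphereArea_eq : sphereArea N = N * (volume : Measure (E N)).real (Metric.ball 0 1) := by
  rw [sphereArea, Measure.toSphere_real_apply_univ, finrank_euclideanSpace_fin]

lemma integral_radial (hN : 3 ≤ N) (f : ℝ → ℝ) :
    ∫ x : E N, f ‖x‖ = sphereArea N * ∫ r in Set.Ioi (0 : ℝ), r ^ (N - 1) * f r := by
  have := nontrivial_of_three_le hN
  rw [integral_fun_norm_addHaar, sphereArea_eq, finrank_euclideanSpace_fin]
  simp [mul_assoc]

lemma integrable_radial (hN : 3 ≤ N) {f : ℝ → ℝ} :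
    Integrable (fun x : E N => f ‖x‖) ↔
      IntegrableOn (fun r : ℝ => r ^ (N - 1) * f r) (Set.Ioi 0) := by
  have := nontrivial_of_three_le hN
  rw [integrable_fun_norm_addHaar, finrank_euclideanSpace_fin]
  simp

lemma sphereArea_pos (hN : 3 ≤ N) : 0 < sphereArea N := by
  rw [sphereArea_eq]
  have h1 : (0 : ℝ) < N := by linarith [three_le_cast hN]
  have h2 : 0 < (volume : Measure (E N)).real (Metric.ball 0 1) :=
    ENNReal.toReal_pos (Metric.measure_ball_pos _ _ one_pos).ne' measure_ball_lt_top.ne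
  positivity

/-- The power `-β` of `ε² + |x|²`. -/
def kernel (β ε : ℝ) (x : E N) : ℝ := (ε ^ 2 + ‖x‖ ^ 2) ^ (-β)

lemma base_pos {ε : ℝ} (hε : 0 < ε) (x : E N) : 0 < ε ^ 2 + ‖x‖ ^ 2 := by positivity

lemma kernel_pos {β ε : ℝ} (hε : 0 < ε) (x : E N) : 0 < kernel β ε x :=
  Real.rpow_pos_of_pos (base_pos hε x) _

lemma continuous_kernel {β ε : ℝ} (hε : 0 < ε) : Continuous (kernel β ε : E N → ℝ) :=
  Continuous.rpow_const (by fun_prop) fun x => Or.inl (base_pos hε x).ne'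

lemma kernel_eq_smul {β ε : ℝ} (hε : 0 < ε) (x : E N) :
    kernel β ε x = ε ^ (-(2 * β)) * kernel β 1 (ε⁻¹ • x) := by
  have h : ε ^ 2 + ‖x‖ ^ 2 = ε ^ 2 * (1 ^ 2 + ‖ε⁻¹ • x‖ ^ 2) := by
    rw [norm_smul, norm_inv, Real.norm_of_nonneg hε.le]
    field_simp
  rw [kernel, kernel, h, Real.mul_rpow (by positivity) (by positivity), ← Real.rpow_natCast,
    ← Real.rpow_mul hε.le]
  congr 2
  push_cast
  ring

lemma integrable_kernel {β ε : ℝ} (hε : 0 < ε) (hβ : (N : ℝ) < 2 * β) :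
    Integrable (kernel β ε : E N → ℝ) := by
  have h : Integrable (kernel β 1 : E N → ℝ) := by
    have := integrable_rpow_neg_one_add_norm_sq (μ := (volume : Measure (E N))) (r := 2 * β)
      (by rwa [finrank_euclideanSpace_fin])
    refine this.congr (Eventually.of_forall fun x => ?_)
    simp only [kernel, one_pow]
    congr 1; ring
  have h2 := (h.comp_smul (inv_ne_zero hε.ne')).const_mul (ε ^ (-(2 * β)))
  exact h2.congr (Eventually.of_forall fun x => (kernel_eq_smul hε x).symm)

/-- The integral of `kernel β 1`. -/
def kernelInt (N : ℕ) (β : ℝ) : ℝ := ∫ x : E N, kernel β 1 x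

lemma integral_kernel {β ε : ℝ} (hε : 0 < ε) :
    ∫ x : E N, kernel β ε x = ε ^ ((N : ℝ) - 2 * β) * kernelInt N β := by
  simp only [kernel_eq_smul hε]
  rw [integral_const_mul, Measure.integral_comp_inv_smul_of_nonneg _ _ hε.le,
    finrank_euclideanSpace_fin, kernelInt, smul_eq_mul, ← mul_assoc, ← Real.rpow_natCast,
    ← Real.rpow_add hε]
  ring_nf

lemma kernelInt_pos {β : ℝ} (hβ : (N : ℝ) < 2 * β) : 0 < kernelInt N β := by
  rw [kernelInt, integral_pos_iff_support_of_nonneg (fun x => (kernel_pos one_pos x).le)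
    (integrable_kernel one_pos hβ)]
  have : Function.support (kernel β 1 : E N → ℝ) = Set.univ :=
    Set.eq_univ_of_forall fun y => (kernel_pos one_pos y).ne'
  rw [this]
  exact Measure.measure_univ_pos.2 (NeZero.ne _)

lemma norm_sq_mul_kernel {β ε : ℝ} (hε : 0 < ε) (x : E N) :
    ‖x‖ ^ 2 * kernel β ε x = kernel (β - 1) ε x - ε ^ 2 * kernel β ε x := by
  have : kernel (β - 1) ε x = (ε ^ 2 + ‖x‖ ^ 2) * kernel β ε x := by
    rw [kernel, kernel, neg_sub, sub_eq_add_neg, Real.rpow_add (base_pos hε x), Real.rpow_one]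
  rw [this]; ring

/-- This is the radial form of the divergence of x(1+|x|²)^{1-N}; its integral over the whole space
is zero. -/
lemma hasDerivAt_pow_div (hN : 3 ≤ N) (r : ℝ) :
    HasDerivAt (fun r : ℝ => r ^ N / (1 + r ^ 2) ^ (N - 1))
      (r ^ (N - 1) * (N * ((1 + r ^ 2) ^ N)⁻¹ - (N - 2) * (r ^ 2 * ((1 + r ^ 2) ^ N)⁻¹))) r := by
  have hpos : 0 < 1 + r ^ 2 := by positivity
  have h1 : HasDerivAt (fun r : ℝ => 1 + r ^ 2) (2 * r) r := by
    simpa using (hasDerivAt_pow 2 r).const_add 1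
  have h2 := (hasDerivAt_pow N r).div (h1.fun_pow (N - 1)) (pow_pos hpos _).ne'
  obtain ⟨k, rfl⟩ : ∃ k, N = k + 2 := ⟨N - 2, by omega⟩
  refine h2.congr_deriv ?_
  simp only [show k + 2 - 1 = k + 1 from rfl, show k + 1 - 1 = k from rfl]
  push_cast
  field_simp
  ring

lemma tendsto_pow_div (hN : 3 ≤ N) :
    Tendsto (fun r : ℝ => r ^ N / (1 + r ^ 2) ^ (N - 1)) atTop (𝓝 0) := by
  refine squeeze_zero' ((eventually_gt_atTop 0).mono fun r hr => by positivity)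
    ((eventually_ge_atTop 1).mono fun r hr => ?_) tendsto_inv_atTop_zero
  have hr0 : (0 : ℝ) < r := by linarith
  rw [div_le_iff₀ (by positivity), inv_mul_eq_div, le_div_iff₀ hr0, ← pow_succ]
  calc r ^ (N + 1) ≤ r ^ (2 * (N - 1)) := pow_le_pow_right₀ hr (by omega)
    _ = (r ^ 2) ^ (N - 1) := pow_mul _ _ _
    _ ≤ (1 + r ^ 2) ^ (N - 1) := pow_le_pow_left₀ (by positivity) (by linarith) _

lemma kernel_natCast (x : E N) : kernel N 1 x = ((1 + ‖x‖ ^ 2) ^ N)⁻¹ := by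
  rw [kernel, one_pow, Real.rpow_neg (by positivity), Real.rpow_natCast]

/-- Integrating the exact derivative gives N ∫ k_N = (N-2) ∫ |x|² k_N, and |x|² k_N = k_{N-1} - k_N.
This one relation evaluates the Dirichlet energy and the transport integrals in terms of `kernelInt
N N`. -/
lemma kernelInt_sub_one (hN : 3 ≤ N) :
    kernelInt N ((N : ℝ) - 1) = 2 * (N - 1) / (N - 2) * kernelInt N N := by
  have h3 := three_le_cast hN
  have hi1 : Integrable (kernel N 1 : E N → ℝ) := integrable_kernel one_pos (by linarith)
  have hi2 : Integrable (kernel ((N : ℝ) - 1) 1 : E N → ℝ) :=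
    integrable_kernel one_pos (by linarith)
  have hnk : ∀ x : E N, ‖x‖ ^ 2 * kernel N 1 x = kernel (N - 1) 1 x - kernel N 1 x := fun x => by
    simpa using norm_sq_mul_kernel (β := N) one_pos x
  set f : ℝ → ℝ := fun r => N * ((1 + r ^ 2) ^ N)⁻¹ - (N - 2) * (r ^ 2 * ((1 + r ^ 2) ^ N)⁻¹)
    with hf
  have hfk : ∀ x : E N, f ‖x‖ = N * kernel N 1 x - (N - 2) * (kernel (N - 1) 1 x - kernel N 1 x) :=
    fun x => by
      rw [← hnk, kernel_natCast]
  have hi3 : Integrable fun x : E N => kernel (N - 1) 1 x - kernel N 1 x := hi2.sub hi1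
  have hint : Integrable fun x : E N => f ‖x‖ := by
    simp only [hfk]
    exact (hi1.const_mul _).sub (hi3.const_mul _)
  have h0 := integral_Ioi_of_hasDerivAt_of_tendsto' (a := 0)
    (fun r _ => hasDerivAt_pow_div hN r) ((integrable_radial hN).1 hint) (tendsto_pow_div hN)
  have h1 := integral_radial hN f
  rw [h0] at h1
  simp only [hfk] at h1
  rw [integral_sub (hi1.const_mul _) (hi3.const_mul _), integral_const_mul,
    integral_const_mul, integral_sub hi2 hi1, zero_pow (by omega), zero_div, sub_zero,
    mul_zero] at h1
  change N * kernelInt N N - (N - 2) * (kernelInt N (N - 1) - kernelInt N N) = 0 at h1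
  have : (N : ℝ) - 2 ≠ 0 := by linarith
  field_simp
  linarith

lemma integral_norm_sq_mul_kernel (hN : 3 ≤ N) {ε : ℝ} (hε : 0 < ε) :
    Integrable (fun x : E N => ‖x‖ ^ 2 * kernel N ε x) ∧
    ∫ x : E N, ‖x‖ ^ 2 * kernel N ε x =
      ε ^ (2 - (N : ℝ)) * (N / (N - 2) * kernelInt N N) := by
  have h3 := three_le_cast hN
  have hi1 : Integrable (kernel N ε : E N → ℝ) := integrable_kernel hε (by linarith)
  have hi2 : Integrable (kernel ((N : ℝ) - 1) ε : E N → ℝ) :=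
    integrable_kernel hε (by linarith)
  simp only [norm_sq_mul_kernel hε]
  refine ⟨hi2.sub (hi1.const_mul _), ?_⟩
  rw [integral_sub hi2 (hi1.const_mul _), integral_const_mul, integral_kernel hε,
    integral_kernel hε, kernelInt_sub_one hN, ← Real.rpow_natCast ε 2,
    ← mul_assoc (ε ^ ((2 : ℕ) : ℝ)), ← Real.rpow_add hε]
  have e1 : (N : ℝ) - 2 * (N - 1) = 2 - N := by ring
  have e2 : ((2 : ℕ) : ℝ) + (N - 2 * N) = 2 - N := by push_cast; ring
  rw [e1, e2]
  have : (N : ℝ) - 2 ≠ 0 := by linarith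
  field_simp
  ring

lemma bubble_eq {ε : ℝ} (hε : 0 < ε) (x : E N) :
    bubble N ε x = ((N : ℝ) * (N - 2) * ε ^ 2) ^ (((N : ℝ) - 2) / 4) *
      kernel (((N : ℝ) - 2) / 2) ε x := by
  rw [bubble, kernel, Real.rpow_neg (base_pos hε x).le, div_eq_mul_inv]

lemma bubbleConst_pos (hN : 3 ≤ N) : 0 < (N : ℝ) * (N - 2) := by
  have := three_le_cast hN
  exact mul_pos (by linarith) (by linarith)

lemma bubble_pos (hN : 3 ≤ N) {ε : ℝ} (hε : 0 < ε) (x : E N) : 0 < bubble N ε x := by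
  rw [bubble_eq hε]
  have := bubbleConst_pos hN
  exact mul_pos (Real.rpow_pos_of_pos (by positivity) _) (kernel_pos hε x)

lemma bubble_rpow (hN : 3 ≤ N) {ε : ℝ} (hε : 0 < ε) (q : ℝ) (x : E N) :
    bubble N ε x ^ q = ((N : ℝ) * (N - 2)) ^ (((N : ℝ) - 2) / 4 * q) *
      ε ^ (((N : ℝ) - 2) / 2 * q) * kernel (((N : ℝ) - 2) / 2 * q) ε x := by
  have hc := bubbleConst_pos hN
  rw [bubble_eq hε, Real.mul_rpow (by positivity) (kernel_pos hε x).le, kernel, kernel,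
    ← Real.rpow_mul (base_pos hε x).le, ← Real.rpow_mul (by positivity),
    Real.mul_rpow hc.le (by positivity), ← Real.rpow_natCast ε 2, ← Real.rpow_mul hε.le]
  congr 1
  · congr 2; push_cast; ring
  · congr 1; ring

lemma critExp_mul (hN : 3 ≤ N) : ((N : ℝ) - 2) / 2 * critExp N = N := by
  have := three_le_cast hN
  have : (N : ℝ) - 2 ≠ 0 := by linarith
  rw [critExp]; field_simp

/-- The integral of the critical power of a bubble. -/
def bubbleEnergy (N : ℕ) : ℝ := ((N : ℝ) * (N - 2)) ^ ((N : ℝ) / 2) * kernelInt N N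

lemma bubbleEnergy_pos (hN : 3 ≤ N) : 0 < bubbleEnergy N :=
  mul_pos (Real.rpow_pos_of_pos (bubbleConst_pos hN) _)
    (kernelInt_pos (by linarith [three_le_cast hN]))

lemma bubble_rpow_critExp (hN : 3 ≤ N) {ε : ℝ} (hε : 0 < ε) (x : E N) :
    bubble N ε x ^ critExp N = ((N : ℝ) * (N - 2)) ^ ((N : ℝ) / 2) * ε ^ (N : ℝ) *
      kernel N ε x := by
  rw [bubble_rpow hN hε, critExp_mul hN]
  congr 3
  have := critExp_mul hN
  linarith

lemma integral_bubble_rpow_critExp (hN : 3 ≤ N) {ε : ℝ} (hε : 0 < ε) :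
    Integrable (fun x : E N => bubble N ε x ^ critExp N) ∧
    ∫ x : E N, bubble N ε x ^ critExp N = bubbleEnergy N := by
  have h3 := three_le_cast hN
  simp only [bubble_rpow_critExp hN hε]
  refine ⟨(integrable_kernel hε (by linarith)).const_mul _, ?_⟩
  rw [integral_const_mul, integral_kernel hε, bubbleEnergy, mul_assoc, ← mul_assoc (ε ^ (N : ℝ)),
    ← Real.rpow_add hε, show (N : ℝ) + (N - 2 * N) = 0 by ring, Real.rpow_zero, one_mul]

/-! ### The sharp Sobolev inequality for test functions -/

variable {N : ℕ}

lemma tendsto_integral_cube {f : (Fin N → ℝ) → ℝ} (hf : Integrable f) :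
    Tendsto (fun k : ℕ => ∫ y in cube N ((k : ℝ) + 1), f y) atTop (𝓝 (∫ y, f y)) := by
  refine AECover.integral_tendsto_of_countably_generated
    ⟨Eventually.of_forall fun y => ?_, fun k => measurableSet_cube _ _⟩ hf
  obtain ⟨k, hk⟩ := exists_nat_ge ‖y‖
  filter_upwards [eventually_ge_atTop k] with j hj
  refine mem_cube.2 fun i => abs_le.1 ?_
  have h1 : (k : ℝ) ≤ j := by exact_mod_cast hj
  have := norm_le_pi_norm y i
  rw [Real.norm_eq_abs] at this
  linarith

/-- The Knothe map acts on the product space `Fin N → ℝ`; identifying it with Euclidean space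
preserves volume. -/
lemma integral_comp_toLp (f : E N → ℝ) :
    ∫ y : Fin N → ℝ, f (WithLp.toLp 2 y) = ∫ x, f x :=
  (PiLp.volume_preserving_toLp (Fin N)).integral_comp
    (MeasurableEquiv.toLp 2 (Fin N → ℝ)).measurableEmbedding f

lemma integrable_comp_toLp {f : E N → ℝ} (hf : Integrable f) :
    Integrable fun y : Fin N → ℝ => f (WithLp.toLp 2 y) :=
  ((PiLp.volume_preserving_toLp (Fin N)).integrable_comp_emb
    (MeasurableEquiv.toLp 2 (Fin N → ℝ)).measurableEmbedding).2 hf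

lemma bubble_rpow_critExp_rpow (hN : 3 ≤ N) (x : E N) :
    (bubble N 1 x ^ critExp N) ^ (1 - 1 / N : ℝ) =
      ((N : ℝ) * (N - 2)) ^ (((N : ℝ) - 1) / 2) * kernel (N - 1) 1 x := by
  have h3 := three_le_cast hN
  have hc := bubbleConst_pos hN
  have hN0 : (N : ℝ) ≠ 0 := by linarith
  have hb : (0 : ℝ) < 1 ^ 2 + ‖x‖ ^ 2 := by positivity
  rw [bubble_rpow_critExp hN one_pos, Real.one_rpow, mul_one,
    Real.mul_rpow (by positivity) (kernel_pos one_pos x).le, kernel, kernel,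
    ← Real.rpow_mul hc.le, ← Real.rpow_mul hb.le]
  congr 2
  · field_simp
  · field_simp

lemma sum_fderiv_comp_toLp {φ : E N → ℝ} (hφ : ContDiff ℝ ∞ φ) (y : Fin N → ℝ) :
    ∑ i, (fderiv ℝ (fun y : Fin N → ℝ => φ (WithLp.toLp 2 y)) y (Pi.single i 1)) ^ 2 =
      ‖∇ φ (WithLp.toLp 2 y)‖ ^ 2 := by
  rw [EuclideanSpace.real_norm_sq_eq]
  refine Finset.sum_congr rfl fun i _ => ?_
  have h1 : HasFDerivAt φ (fderiv ℝ φ (WithLp.toLp 2 y)) (WithLp.toLp 2 y) :=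
    ((hφ.differentiable (by simp)) _).hasFDerivAt
  have h2 := h1.comp y
    ((PiLp.continuousLinearEquiv 2 ℝ (fun _ : Fin N => ℝ)).symm.hasFDerivAt (x := y))
  have h3 : fderiv ℝ (fun y : Fin N → ℝ => φ (WithLp.toLp 2 y)) y = _ := h2.fderiv
  rw [h3]
  change (fderiv ℝ φ (WithLp.toLp 2 y) (WithLp.toLp 2 (Pi.single i 1))) ^ 2 = _
  rw [← inner_gradient_left]
  change (inner ℝ _ (EuclideanSpace.single i (1 : ℝ))) ^ 2 = _
  rw [EuclideanSpace.inner_single_right]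
  simp

/-- The sharp Sobolev inequality for test functions. -/
theorem sobolev_inequality_test (hN : 3 ≤ N) {φ : E N → ℝ} (hφ : ContDiff ℝ ∞ φ)
    (hc : HasCompactSupport φ) :
    bubbleEnergy N ^ (1 / N : ℝ) * (∫ x, |φ x| ^ critExp N) ^ (1 / critExp N) ≤
      √(∫ x, ‖∇ φ x‖ ^ 2) := by
  have h3 := three_le_cast hN
  have hN2 : (0 : ℝ) < N - 2 := by linarith
  have hN0 : (0 : ℝ) < N := by linarith
  have hm0 := critExp_pos hN
  have hc0 := bubbleConst_pos hN
  set A := ∫ x, |φ x| ^ critExp N with hA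
  have hA0 : 0 ≤ A := integral_nonneg fun x => Real.rpow_nonneg (abs_nonneg _) _
  rcases hA0.eq_or_lt with h0 | hApos
  · rw [← h0, Real.zero_rpow (by positivity), mul_zero]
    exact Real.sqrt_nonneg _
  set K := bubbleEnergy N with hK
  have hK0 : 0 < K := bubbleEnergy_pos hN
  set D := ∫ x, ‖∇ φ x‖ ^ 2 with hD
  set φ' : (Fin N → ℝ) → ℝ := fun y => φ (WithLp.toLp 2 y) with hφ'
  have hφ'c : ContDiff ℝ 1 φ' :=
    (hφ.of_le (by exact_mod_cast le_top)).comp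
      (PiLp.continuousLinearEquiv 2 ℝ (fun _ : Fin N => ℝ)).symm.contDiff
  have hφ's : HasCompactSupport φ' :=
    hc.comp_homeomorph (PiLp.continuousLinearEquiv 2 ℝ (fun _ : Fin N => ℝ)).symm.toHomeomorph
  set g : E N → ℝ := fun x => bubble N 1 x ^ critExp N with hg
  set G : (Fin N → ℝ) → ℝ := fun y => g (WithLp.toLp 2 y) with hG
  have hg0 : ∀ x, 0 < g x := fun x => Real.rpow_pos_of_pos (bubble_pos hN one_pos x) _
  have hgc : Continuous g := by
    have : g = fun x => ((N : ℝ) * (N - 2)) ^ ((N : ℝ) / 2) * (1 : ℝ) ^ (N : ℝ) * kernel N 1 x :=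
      funext fun x => bubble_rpow_critExp hN one_pos x
    rw [this]
    exact (continuous_kernel one_pos).const_mul _
  have hGc : Continuous G := hgc.comp (PiLp.continuous_toLp 2 _)
  have hG0 : ∀ y, 0 < G y := fun y => hg0 _
  have hGi : Integrable G := integrable_comp_toLp (integral_bubble_rpow_critExp hN one_pos).1
  have hGint : ∫ y, G y = K :=
    (integral_comp_toLp g).trans (integral_bubble_rpow_critExp hN one_pos).2
  have hQ : Integrable (fun x : E N => ‖x‖ ^ 2 * g x) ∧
      ∫ x : E N, ‖x‖ ^ 2 * g x = N / (N - 2) * K := by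
    have h := integral_norm_sq_mul_kernel hN one_pos
    have h' : ∀ x : E N, ‖x‖ ^ 2 * g x =
        ((N : ℝ) * (N - 2)) ^ ((N : ℝ) / 2) * (‖x‖ ^ 2 * kernel N 1 x) := fun x => by
      simp only [hg, bubble_rpow_critExp hN one_pos, Real.one_rpow]; ring
    simp only [h']
    refine ⟨h.1.const_mul _, ?_⟩
    rw [integral_const_mul, h.2, hK, bubbleEnergy, Real.one_rpow]
    ring
  have hnorm : ∀ y : Fin N → ℝ, ∑ i, y i ^ 2 = ‖(WithLp.toLp 2 y : E N)‖ ^ 2 := fun y => by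
    rw [EuclideanSpace.real_norm_sq_eq]
  have hQi : Integrable fun y : Fin N → ℝ => (∑ i, y i ^ 2) * G y := by
    simp only [hnorm]
    exact integrable_comp_toLp hQ.1
  have hQint : ∫ y : Fin N → ℝ, (∑ i, y i ^ 2) * G y = N / (N - 2) * K := by
    simp only [hnorm]
    exact (integral_comp_toLp (fun x : E N => ‖x‖ ^ 2 * g x)).trans hQ.2
  have hL : Integrable (fun y => G y ^ (1 - 1 / N : ℝ)) ∧ ∫ y, G y ^ (1 - 1 / N : ℝ) =
      ((N : ℝ) * (N - 2)) ^ (-(1 / 2) : ℝ) * (2 * (N - 1) / (N - 2)) * K := by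
    have h' : ∀ y, G y ^ (1 - 1 / N : ℝ) =
        ((N : ℝ) * (N - 2)) ^ (((N : ℝ) - 1) / 2) * kernel (N - 1) 1 (WithLp.toLp 2 y : E N) :=
      fun y => bubble_rpow_critExp_rpow hN _
    simp only [h']
    have hi : Integrable (kernel ((N : ℝ) - 1) 1 : E N → ℝ) :=
      integrable_kernel one_pos (by linarith)
    refine ⟨(integrable_comp_toLp hi).const_mul _, ?_⟩
    rw [integral_const_mul, integral_comp_toLp (kernel ((N : ℝ) - 1) 1)]
    change _ * kernelInt N ((N : ℝ) - 1) = _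
    rw [kernelInt_sub_one hN, hK, bubbleEnergy,
      show ((N : ℝ) - 1) / 2 = -(1 / 2) + N / 2 by ring, Real.rpow_add hc0]
    ring
  have hA' : ∫ y, |φ' y| ^ critExp N = A := integral_comp_toLp fun x => |φ x| ^ critExp N
  have hD' : ∫ y, ∑ i, (fderiv ℝ φ' y (Pi.single i 1)) ^ 2 = D := by
    simp only [hφ', sum_fderiv_comp_toLp hφ]
    exact integral_comp_toLp fun x => ‖∇ φ x‖ ^ 2
  have hexp : (0 : ℝ) < 1 / 2 - 1 / N := by
    rw [sub_pos]
    exact one_div_lt_one_div_of_lt two_pos (by linarith)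
  -- Transport reaches only bounded cubes. The left side converges along the exhaustion, while the
  -- positive integrals on the right are bounded by those over the whole space.
  have hlim : ∫ y, G y ^ (1 - 1 / N : ℝ) ≤ (2 * (N - 1) / (N * (N - 2)) : ℝ) *
      (K / A) ^ (1 / 2 - 1 / N : ℝ) * (√D * √(N / (N - 2) * K)) := by
    refine le_of_tendsto (tendsto_integral_cube hL.1) (Eventually.of_forall fun k => ?_)
    have h := integral_cube_rpow_le hN hφ'c hφ's hGc hG0 (M := (k : ℝ) + 1) (by positivity)
      (by rw [hA']; exact hApos)
    rw [hA', hD'] at h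
    refine h.trans ?_
    have hGk : ∫ y in cube N ((k : ℝ) + 1), G y ≤ K := by
      rw [← hGint]
      exact setIntegral_le_integral hGi (Eventually.of_forall fun y => (hG0 y).le)
    have hQk : ∫ y in cube N ((k : ℝ) + 1), (∑ i, y i ^ 2) * G y ≤ N / (N - 2) * K := by
      rw [← hQint]
      exact setIntegral_le_integral hQi (Eventually.of_forall fun y =>
        mul_nonneg (Finset.sum_nonneg fun i _ => sq_nonneg _) (hG0 y).le)
    have hGk0 : 0 ≤ ∫ y in cube N ((k : ℝ) + 1), G y := integral_nonneg fun y => (hG0 y).le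
    have : (0 : ℝ) ≤ N - 1 := by linarith
    gcongr
  rw [hL.2] at hlim
  set c := (N : ℝ) * (N - 2) with hcdef
  have hs1 : √(N / (N - 2) * K) = N * c ^ (-(1 / 2) : ℝ) * K ^ (1 / 2 : ℝ) := by
    have : (N : ℝ) / (N - 2) * K = N ^ 2 * (c⁻¹ * K) := by rw [hcdef]; field_simp
    rw [this, Real.sqrt_mul (by positivity), Real.sqrt_sq hN0.le, Real.sqrt_mul (by positivity),
      Real.sqrt_eq_rpow, Real.sqrt_eq_rpow, Real.inv_rpow hc0.le, Real.rpow_neg hc0.le]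
    ring
  have hm : (1 / critExp N : ℝ) = 1 / 2 - 1 / N := by
    rw [critExp]; field_simp
  have hck : 0 < c ^ (-(1 / 2) : ℝ) := Real.rpow_pos_of_pos hc0 _
  rw [hs1, Real.div_rpow hK0.le hA0] at hlim
  rw [hm]
  have hAe : 0 < A ^ (1 / 2 - 1 / N : ℝ) := Real.rpow_pos_of_pos hApos _
  -- The powers of K on the right of `hlim`; what is missing to make K is exactly K^{1/N}.
  set kap := K ^ (1 / 2 - 1 / N : ℝ) * K ^ (1 / 2 : ℝ) with hkap
  have hkap0 : 0 < kap := by positivity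
  have hKK : K = K ^ (1 / N : ℝ) * kap := by
    rw [hkap, ← Real.rpow_add hK0, ← Real.rpow_add hK0]
    conv_lhs => rw [← Real.rpow_one K]
    congr 1; ring
  -- The prefactor is the same constant as on the left of `hlim`. This exact cancellation is the
  -- sharpness of the inequality.
  have hrew : (2 * (N - 1) / (N * (N - 2)) : ℝ) *
      (K ^ (1 / 2 - 1 / N : ℝ) / A ^ (1 / 2 - 1 / N : ℝ)) *
        (√D * (N * c ^ (-(1 / 2) : ℝ) * K ^ (1 / 2 : ℝ))) =
      c ^ (-(1 / 2) : ℝ) * (2 * (N - 1) / (N - 2)) * (kap * (√D / A ^ (1 / 2 - 1 / N : ℝ))) := by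
    rw [hkap]; field_simp
  rw [hrew] at hlim
  have hpos : 0 < c ^ (-(1 / 2) : ℝ) * (2 * (N - 1) / (N - 2)) := by
    have : (0 : ℝ) < N - 1 := by linarith
    positivity
  have h5 := le_of_mul_le_mul_left hlim hpos
  conv_lhs at h5 => rw [hKK, mul_comm]
  have h6 := le_of_mul_le_mul_left h5 hkap0
  rwa [le_div_iff₀ hAe] at h6

/-! ### The truncated bubble -/

variable {N : ℕ}

lemma lpNorm_rpow {F : Type*} [NormedAddCommGroup F] {f : E N → F}
    (hf : AEStronglyMeasurable f volume) {q : ℝ} (hq : 0 < q) :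
    lpNorm f (ENNReal.ofReal q) volume ^ q = ∫ x, ‖f x‖ ^ q := by
  rw [lpNorm_eq_integral_norm_rpow_toReal (by simpa using hq) ENNReal.ofReal_ne_top hf,
    ENNReal.toReal_ofReal hq.le, ← Real.rpow_mul (integral_nonneg fun x => by positivity),
    inv_mul_cancel₀ hq.ne', Real.rpow_one]

lemma lpNorm_two_sq {F : Type*} [NormedAddCommGroup F] {f : E N → F}
    (hf : AEStronglyMeasurable f volume) : lpNorm f 2 volume ^ 2 = ∫ x, ‖f x‖ ^ 2 := by
  simpa using lpNorm_rpow hf (q := 2) two_pos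

namespace IsCutoff

variable {ξ : E N → ℝ}

/-- Compare with a point farther out than both x and radius 2, where ξ vanishes. -/
lemma nonneg (hξ : IsCutoff N ξ) (hN : 3 ≤ N) (x : E N) : 0 ≤ ξ x := by
  have := nontrivial_of_three_le hN
  obtain ⟨y, hy⟩ := NormedSpace.exists_lt_norm ℝ (E N) (max 2 ‖x‖)
  rw [← hξ.eq_zero y (by simpa using (le_max_left _ _).trans hy.le)]
  exact hξ.antitone x y ((le_max_right _ _).trans hy.le)

lemma le_one (hξ : IsCutoff N ξ) (x : E N) : ξ x ≤ 1 := by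
  rw [← hξ.eq_one 0 (by simp)]
  exact hξ.antitone 0 x (by simp)

lemma hasCompactSupport (hξ : IsCutoff N ξ) : HasCompactSupport ξ :=
  HasCompactSupport.intro (isCompact_closedBall (0 : E N) 2) fun x hx =>
    hξ.eq_zero x fun h => hx (Metric.ball_subset_closedBall h)

lemma rpow_mem (hξ : IsCutoff N ξ) (hN : 3 ≤ N) {q : ℝ} (hq : 0 ≤ q) (x : E N) :
    ξ x ^ q ∈ Set.Icc 0 1 :=
  ⟨Real.rpow_nonneg (hξ.nonneg hN x) _, Real.rpow_le_one (hξ.nonneg hN x) (hξ.le_one x) hq⟩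

lemma continuous_rpow (hξ : IsCutoff N ξ) {q : ℝ} (hq : 0 ≤ q) : Continuous fun x => ξ x ^ q :=
  hξ.smooth.continuous.rpow_const fun _ => Or.inr hq

lemma hasCompactSupport_rpow (hξ : IsCutoff N ξ) {q : ℝ} (hq : 0 < q) :
    HasCompactSupport fun x => ξ x ^ q :=
  HasCompactSupport.intro (isCompact_closedBall (0 : E N) 2) fun x hx => by
    rw [hξ.eq_zero x fun h => hx (Metric.ball_subset_closedBall h), Real.zero_rpow hq.ne']

lemma integrable_rpow_mul_kernel (hξ : IsCutoff N ξ) {q β ε : ℝ} (hq : 0 < q) (hε : 0 < ε) :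
    Integrable fun x => ξ x ^ q * kernel β ε x :=
  ((hξ.continuous_rpow hq.le).mul (continuous_kernel hε)).integrable_of_hasCompactSupport
    (hξ.hasCompactSupport_rpow hq).mul_right

end IsCutoff

/-- Off the unit ball ε² + |x|² ≥ (1 + |x|²)/2, so the bound does not depend on ε. -/
lemma kernel_le {β ε : ℝ} (hβ : 0 ≤ β) (hε : 0 < ε) {x : E N} (hx : 1 ≤ ‖x‖) :
    kernel β ε x ≤ 2 ^ β * kernel β 1 x := by
  have hb : (0 : ℝ) < 1 ^ 2 + ‖x‖ ^ 2 := by positivity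
  have h1 : ((1 ^ 2 + ‖x‖ ^ 2) / 2 : ℝ) ≤ ε ^ 2 + ‖x‖ ^ 2 := by nlinarith [sq_nonneg ε]
  calc kernel β ε x ≤ ((1 ^ 2 + ‖x‖ ^ 2) / 2) ^ (-β) :=
        Real.rpow_le_rpow_of_nonpos (by positivity) h1 (by linarith)
    _ = _ := by
        rw [Real.div_rpow hb.le two_pos.le, Real.rpow_neg two_pos.le, div_inv_eq_mul, mul_comm,
          kernel]

section Trunc

variable {ξ : E N → ℝ}

/-- The integrands agree on the unit ball; outside, the difference is at most the kernel, controlled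
by `kernel_le`. The error stays bounded while the main term blows up as ε → 0. -/
lemma abs_integral_cutoff_mul_kernel_sub_le (hN : 3 ≤ N) (hξ : IsCutoff N ξ) {q β ε : ℝ}
    (hq : 0 < q) (hβ : (N : ℝ) < 2 * β) (hε : 0 < ε) :
    |(∫ x, ξ x ^ q * kernel β ε x) - ε ^ ((N : ℝ) - 2 * β) * kernelInt N β| ≤
      2 ^ β * kernelInt N β := by
  have h3 := three_le_cast hN
  rw [← integral_kernel hε, ← integral_sub (hξ.integrable_rpow_mul_kernel hq hε)
    (integrable_kernel hε hβ), kernelInt, ← integral_const_mul]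
  refine abs_integral_le_integral_abs.trans ?_
  refine integral_mono
    ((hξ.integrable_rpow_mul_kernel hq hε).sub (integrable_kernel hε hβ)).abs
    ((integrable_kernel one_pos hβ).const_mul _) fun x => ?_
  have hk := (kernel_pos (β := β) hε x).le
  have hk1 := (kernel_pos (β := β) one_pos x).le
  have hmem := hξ.rpow_mem hN hq.le x
  simp only
  rcases lt_or_ge ‖x‖ 1 with hx | hx
  · rw [hξ.eq_one x (by simpa using hx), Real.one_rpow, one_mul, sub_self, abs_zero]
    positivity
  · refine le_trans ?_ (kernel_le (by linarith) hε hx)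
    rw [abs_le]
    constructor <;> nlinarith [hmem.1, hmem.2]

lemma contDiff_kernel {β ε : ℝ} (hε : 0 < ε) : ContDiff ℝ ∞ (kernel β ε : E N → ℝ) :=
  ContDiff.rpow_const_of_ne (contDiff_const.add (contDiff_norm_sq ℝ)) fun x => (base_pos hε x).ne'

lemma contDiff_bubble {ε : ℝ} (hε : 0 < ε) : ContDiff ℝ ∞ (bubble N ε) := by
  have : bubble N ε = fun x => ((N : ℝ) * (N - 2) * ε ^ 2) ^ (((N : ℝ) - 2) / 4) *
      kernel (((N : ℝ) - 2) / 2) ε x := funext fun x => bubble_eq hε x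
  rw [this]
  exact contDiff_const.mul (contDiff_kernel hε)

lemma contDiff_truncBubble (hξ : IsCutoff N ξ) {ε : ℝ} (hε : 0 < ε) :
    ContDiff ℝ ∞ (truncBubble N ξ ε) :=
  hξ.smooth.mul (contDiff_bubble hε)

lemma hasCompactSupport_truncBubble (hξ : IsCutoff N ξ) (ε : ℝ) :
    HasCompactSupport (truncBubble N ξ ε) :=
  hξ.hasCompactSupport.mul_right

/-- Reduces every norm expansion to one integral with β = (N-2)q/2; the position of 2β relative to N
separates the three regimes. -/
lemma lpNorm_truncBubble_rpow (hN : 3 ≤ N) (hξ : IsCutoff N ξ) {q ε : ℝ} (hq : 0 < q)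
    (hε : 0 < ε) :
    lpNorm (truncBubble N ξ ε) (ENNReal.ofReal q) volume ^ q =
      ((N : ℝ) * (N - 2)) ^ (((N : ℝ) - 2) / 4 * q) * ε ^ (((N : ℝ) - 2) / 2 * q) *
        ∫ x, ξ x ^ q * kernel (((N : ℝ) - 2) / 2 * q) ε x := by
  rw [lpNorm_rpow (contDiff_truncBubble hξ hε).continuous.aestronglyMeasurable hq,
    ← integral_const_mul]
  refine integral_congr_ae (Eventually.of_forall fun x => ?_)
  have h0 := hξ.nonneg hN x
  have h1 := (bubble_pos hN hε x).le
  simp only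
  rw [truncBubble, Real.norm_of_nonneg (mul_nonneg h0 h1), Real.mul_rpow h0 h1,
    bubble_rpow hN hε]
  ring

/-! ### Gradients and the Dirichlet integral of the truncated bubble -/

lemma continuous_gradient {f : E N → ℝ} (hf : ContDiff ℝ ∞ f) : Continuous (∇ f) :=
  (InnerProductSpace.toDual ℝ (E N)).symm.continuous.comp
    (hf.continuous_fderiv (by simp))

lemma hasCompactSupport_gradient {f : E N → ℝ} (hf : HasCompactSupport f) :
    HasCompactSupport (∇ f) :=
  (hf.fderiv ℝ).comp_left (map_zero (InnerProductSpace.toDual ℝ (E N)).symm)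

lemma gradient_mul {f g : E N → ℝ} {x : E N} (hf : DifferentiableAt ℝ f x)
    (hg : DifferentiableAt ℝ g x) : ∇ (fun x => f x * g x) x = f x • ∇ g x + g x • ∇ f x := by
  simp only [gradient]
  rw [fderiv_fun_mul hf hg, map_add, map_smulₛₗ, map_smulₛₗ]
  simp

lemma hasGradientAt_kernel {β ε : ℝ} (hε : 0 < ε) (x : E N) :
    HasGradientAt (kernel β ε) (-(2 * β * kernel (β + 1) ε x) • x) x := by
  rw [hasGradientAt_iff_hasFDerivAt]
  have h1 : HasFDerivAt (fun x : E N => ε ^ 2 + ‖x‖ ^ 2) (2 • innerSL ℝ x) x :=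
    (hasStrictFDerivAt_norm_sq x).hasFDerivAt.const_add _
  have h2 := h1.rpow_const (p := -β) (Or.inl (base_pos hε x).ne')
  refine h2.congr_fderiv ?_
  ext y
  simp only [kernel, neg_add, ← sub_eq_add_neg]
  simp
  ring

lemma norm_gradient_bubble_sq (hN : 3 ≤ N) {ε : ℝ} (hε : 0 < ε) (x : E N) :
    ‖∇ (bubble N ε) x‖ ^ 2 = ((N : ℝ) - 2) ^ 2 * ((N : ℝ) * (N - 2)) ^ (((N : ℝ) - 2) / 2) *
      ε ^ ((N : ℝ) - 2) * (‖x‖ ^ 2 * kernel N ε x) := by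
  have hc := bubbleConst_pos hN
  have hk := hasGradientAt_kernel (β := ((N : ℝ) - 2) / 2) hε x
  have hb : bubble N ε = fun x => ((N : ℝ) * (N - 2) * ε ^ 2) ^ (((N : ℝ) - 2) / 4) *
      kernel (((N : ℝ) - 2) / 2) ε x := funext fun x => bubble_eq hε x
  rw [hb, gradient_mul (differentiableAt_const _) hk.differentiableAt, gradient_fun_const,
    smul_zero, add_zero, hk.gradient, norm_smul, norm_smul, mul_pow, mul_pow, Real.norm_eq_abs,
    Real.norm_eq_abs, sq_abs, sq_abs, neg_sq, mul_pow]
  have e1 : (((N : ℝ) * (N - 2) * ε ^ 2) ^ (((N : ℝ) - 2) / 4)) ^ 2 =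
      ((N : ℝ) * (N - 2)) ^ (((N : ℝ) - 2) / 2) * ε ^ ((N : ℝ) - 2) := by
    rw [← Real.rpow_natCast (_ ^ (_ : ℝ)) 2, ← Real.rpow_mul (by positivity),
      Real.mul_rpow hc.le (by positivity), ← Real.rpow_natCast ε 2, ← Real.rpow_mul hε.le]
    congr 2 <;> push_cast <;> ring
  have e2 : (kernel (((N : ℝ) - 2) / 2 + 1) ε x) ^ 2 = kernel N ε x := by
    rw [kernel, kernel, ← Real.rpow_natCast (_ ^ (_ : ℝ)) 2, ← Real.rpow_mul (base_pos hε x).le]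
    congr 1; push_cast; ring
  rw [e1, e2]
  ring

/-- The factor N(N-2) in the bubble is chosen so that the Dirichlet and critical integrals coincide;
here this follows from the second moment of the kernel. -/
lemma integral_norm_gradient_bubble_sq (hN : 3 ≤ N) {ε : ℝ} (hε : 0 < ε) :
    Integrable (fun x => ‖∇ (bubble N ε) x‖ ^ 2) ∧
    ∫ x, ‖∇ (bubble N ε) x‖ ^ 2 = bubbleEnergy N := by
  have h := integral_norm_sq_mul_kernel hN hε
  have h3 := three_le_cast hN
  have hc := bubbleConst_pos hN
  have hN2 : (N : ℝ) - 2 ≠ 0 := by linarith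
  simp only [norm_gradient_bubble_sq hN hε]
  refine ⟨h.1.const_mul _, ?_⟩
  have e : (N : ℝ) / 2 = (N - 2) / 2 + 1 := by ring
  have e3 : ε ^ ((N : ℝ) - 2) * ε ^ (2 - (N : ℝ)) = 1 := by
    rw [← Real.rpow_add hε]; simp
  rw [integral_const_mul, h.2, bubbleEnergy, e, Real.rpow_add hc, Real.rpow_one]
  calc _ = ((N : ℝ) - 2) ^ 2 * ((N : ℝ) * (N - 2)) ^ (((N : ℝ) - 2) / 2) *
      (N / (N - 2) * kernelInt N N) * (ε ^ ((N : ℝ) - 2) * ε ^ (2 - (N : ℝ))) := by ring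
    _ = _ := by rw [e3]; field_simp

/-- Pointwise majorant, up to the power `N - 2` of `ε`, of the error made in the Dirichlet integral
by truncating a bubble. -/
def gradientMajorant (N : ℕ) (ξ : E N → ℝ) (x : E N) : ℝ :=
  ((N : ℝ) * (N - 2)) ^ (((N : ℝ) - 2) / 2) *
    (2 * (((N : ℝ) - 2) ^ 2 * (2 ^ (N : ℝ) * (‖x‖ ^ 2 * kernel N 1 x))) +
      2 * (2 ^ ((N : ℝ) - 2) * (‖∇ ξ x‖ ^ 2 * kernel (N - 2) 1 x)))

lemma gradientMajorant_nonneg (hN : 3 ≤ N) (x : E N) : 0 ≤ gradientMajorant N ξ x := by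
  have hκ0 := Real.rpow_pos_of_pos (bubbleConst_pos hN) (((N : ℝ) - 2) / 2)
  have h1 := (kernel_pos (β := N) one_pos x).le
  have h2 := (kernel_pos (β := N - 2) one_pos x).le
  unfold gradientMajorant
  positivity

lemma integrable_gradientMajorant (hN : 3 ≤ N) (hξ : IsCutoff N ξ) :
    Integrable (gradientMajorant N ξ) := by
  have hi1 := (integral_norm_sq_mul_kernel hN one_pos).1
  have hi2 : Integrable fun x => ‖∇ ξ x‖ ^ 2 * kernel (N - 2) 1 x := by
    refine Continuous.integrable_of_hasCompactSupport
      (((continuous_gradient hξ.smooth).norm.pow 2).mul (continuous_kernel one_pos)) ?_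
    refine HasCompactSupport.intro (hasCompactSupport_gradient hξ.hasCompactSupport) fun x hx => ?_
    rw [image_eq_zero_of_notMem_tsupport hx, norm_zero, zero_pow two_ne_zero, zero_mul]
  exact ((((hi1.const_mul _).const_mul _).const_mul _).add
    ((hi2.const_mul _).const_mul _)).const_mul _

lemma norm_add_smul_sq_le {v w : E N} {a b : ℝ} (ha : 0 ≤ a) (ha1 : a ≤ 1) (hb : 0 ≤ b) :
    ‖a • v + b • w‖ ^ 2 ≤ 2 * ‖v‖ ^ 2 + 2 * (b ^ 2 * ‖w‖ ^ 2) := by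
  have h4 : ‖a • v + b • w‖ ≤ ‖v‖ + b * ‖w‖ := by
    refine (norm_add_le _ _).trans ?_
    rw [norm_smul, norm_smul, Real.norm_of_nonneg ha, Real.norm_of_nonneg hb]
    exact add_le_add_left (mul_le_of_le_one_left (norm_nonneg _) ha1) _
  calc _ ≤ (‖v‖ + b * ‖w‖) ^ 2 := pow_le_pow_left₀ (norm_nonneg _) h4 2
    _ ≤ _ := by nlinarith [sq_nonneg (‖v‖ - b * ‖w‖)]

/-- Off the unit ball u_ε² and |∇u_ε|² are both ε^{N-2} times a kernel bounded uniformly in ε by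
`kernel_le`. -/
lemma tail_le_gradientMajorant (hN : 3 ≤ N) {ε : ℝ} (hε : 0 < ε) {x : E N} (hx : 1 ≤ ‖x‖) :
    2 * ‖∇ (bubble N ε) x‖ ^ 2 + 2 * (bubble N ε x ^ 2 * ‖∇ ξ x‖ ^ 2) ≤
      gradientMajorant N ξ x * ε ^ ((N : ℝ) - 2) := by
  have h3 := three_le_cast hN
  have hκ0 := Real.rpow_pos_of_pos (bubbleConst_pos hN) (((N : ℝ) - 2) / 2)
  have hεp : 0 < ε ^ ((N : ℝ) - 2) := Real.rpow_pos_of_pos hε _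
  have hb := bubble_rpow hN hε 2 x
  rw [show ((N : ℝ) - 2) / 4 * 2 = (N - 2) / 2 by ring,
    show ((N : ℝ) - 2) / 2 * 2 = N - 2 by ring, Real.rpow_two] at hb
  rw [norm_gradient_bubble_sq hN hε, hb, gradientMajorant]
  set κ := ((N : ℝ) * (N - 2)) ^ (((N : ℝ) - 2) / 2)
  set e := ε ^ ((N : ℝ) - 2)
  have k1 := mul_le_mul_of_nonneg_left (kernel_le (β := N) (by linarith) hε hx)
    (show 0 ≤ ((N : ℝ) - 2) ^ 2 * κ * e * ‖x‖ ^ 2 by positivity)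
  have k2 := mul_le_mul_of_nonneg_left (kernel_le (β := (N : ℝ) - 2) (by linarith) hε hx)
    (show 0 ≤ κ * e * ‖∇ ξ x‖ ^ 2 by positivity)
  linarith

/-- On the open unit ball ξ is locally 1 and the gradients agree. Outside no cancellation is needed:
both squares are already of order ε^{N-2}. -/
lemma abs_gradient_truncBubble_sub_le (hN : 3 ≤ N) (hξ : IsCutoff N ξ) {ε : ℝ} (hε : 0 < ε)
    (x : E N) :
    |‖∇ (truncBubble N ξ ε) x‖ ^ 2 - ‖∇ (bubble N ε) x‖ ^ 2| ≤
      gradientMajorant N ξ x * ε ^ ((N : ℝ) - 2) := by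
  have hgr : ∇ (truncBubble N ξ ε) x = ξ x • ∇ (bubble N ε) x + bubble N ε x • ∇ ξ x :=
    gradient_mul (hξ.smooth.differentiable (by simp) x)
      ((contDiff_bubble hε).differentiable (by simp) x)
  rw [hgr]
  rcases lt_or_ge ‖x‖ 1 with hx | hx
  · have hev : ξ =ᶠ[𝓝 x] fun _ => 1 := by
      filter_upwards [Metric.isOpen_ball.mem_nhds
        (show x ∈ Metric.ball (0 : E N) 1 by simpa using hx)] with y hy using hξ.eq_one y hy
    rw [hev.gradient_eq, gradient_fun_const, hev.eq_of_nhds, smul_zero, add_zero, one_smul,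
      sub_self, abs_zero]
    exact mul_nonneg (gradientMajorant_nonneg hN x) (Real.rpow_pos_of_pos hε _).le
  · have hle := norm_add_smul_sq_le (v := ∇ (bubble N ε) x) (w := ∇ ξ x) (hξ.nonneg hN x)
      (hξ.le_one x) (bubble_pos hN hε x).le
    have hsum := tail_le_gradientMajorant (ξ := ξ) hN hε hx
    have h1 := sq_nonneg ‖∇ (bubble N ε) x‖
    have h2 := sq_nonneg ‖ξ x • ∇ (bubble N ε) x + bubble N ε x • ∇ ξ x‖
    have h4 : 0 ≤ bubble N ε x ^ 2 * ‖∇ ξ x‖ ^ 2 := mul_nonneg (sq_nonneg _) (sq_nonneg _)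
    rw [abs_le]
    constructor <;> linarith

lemma integrable_norm_gradient_sq {f : E N → ℝ} (hf : ContDiff ℝ ∞ f) (hc : HasCompactSupport f) :
    Integrable fun x => ‖∇ f x‖ ^ 2 := by
  have h1 : Continuous fun x => ‖∇ f x‖ ^ 2 := (continuous_gradient hf).norm.pow 2
  have h2 : HasCompactSupport fun x => ‖∇ f x‖ ^ 2 :=
    HasCompactSupport.intro (hasCompactSupport_gradient hc) fun x hx => by
      rw [image_eq_zero_of_notMem_tsupport hx, norm_zero, zero_pow two_ne_zero]
  exact h1.integrable_of_hasCompactSupport h2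

lemma abs_integral_gradient_truncBubble_sub_le (hN : 3 ≤ N) (hξ : IsCutoff N ξ) {ε : ℝ}
    (hε : 0 < ε) :
    |(∫ x, ‖∇ (truncBubble N ξ ε) x‖ ^ 2) - bubbleEnergy N| ≤
      (∫ x, gradientMajorant N ξ x) * ε ^ ((N : ℝ) - 2) := by
  have hUi := integrable_norm_gradient_sq (contDiff_truncBubble hξ hε)
    (hasCompactSupport_truncBubble hξ ε)
  have hbi := integral_norm_gradient_bubble_sq hN hε
  rw [← hbi.2, ← integral_sub hUi hbi.1, ← integral_mul_const]
  refine abs_integral_le_integral_abs.trans ?_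
  refine integral_mono (hUi.sub hbi.1).abs
    ((integrable_gradientMajorant hN hξ).mul_const _) fun x => ?_
  exact abs_gradient_truncBubble_sub_le hN hξ hε x

theorem isBigO_gradient_truncBubble (hN : 3 ≤ N) (hξ : IsCutoff N ξ) :
    (fun ε : ℝ => lpNorm (∇ (truncBubble N ξ ε)) 2 volume ^ 2 - bubbleEnergy N)
      =O[𝓝[>] 0] fun ε : ℝ => ε ^ ((N : ℝ) - 2) := by
  refine IsBigO.of_bound (∫ x, gradientMajorant N ξ x) ?_
  filter_upwards [self_mem_nhdsWithin] with ε (hε : 0 < ε)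
  have hεp : 0 < ε ^ ((N : ℝ) - 2) := Real.rpow_pos_of_pos hε _
  have hm : AEStronglyMeasurable (∇ (truncBubble N ξ ε)) volume :=
    (continuous_gradient (contDiff_truncBubble hξ hε)).aestronglyMeasurable
  rw [lpNorm_two_sq hm, Real.norm_eq_abs, Real.norm_of_nonneg hεp.le]
  exact abs_integral_gradient_truncBubble_sub_le hN hξ hε

/-- Here β = N: the prefactor ε^N cancels the scaling ε^{N-2N} of the main term and multiplies a
bounded truncation error. -/
theorem isBigO_truncBubble_critExp (hN : 3 ≤ N) (hξ : IsCutoff N ξ) :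
    (fun ε : ℝ => lpNorm (truncBubble N ξ ε) (ENNReal.ofReal (critExp N)) volume ^ critExp N -
        bubbleEnergy N) =O[𝓝[>] 0] fun ε : ℝ => ε ^ (N : ℝ) := by
  have h3 := three_le_cast hN
  have hc := bubbleConst_pos hN
  have hm := critExp_mul hN
  set κ := ((N : ℝ) * (N - 2)) ^ ((N : ℝ) / 2) with hκ
  have hκ0 : 0 < κ := Real.rpow_pos_of_pos hc _
  refine IsBigO.of_bound (κ * (2 ^ (N : ℝ) * kernelInt N N)) ?_
  filter_upwards [self_mem_nhdsWithin] with ε (hε : 0 < ε)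
  have h := abs_integral_cutoff_mul_kernel_sub_le hN hξ (β := N) (critExp_pos hN) (by linarith) hε
  have hεp : 0 < ε ^ (N : ℝ) := Real.rpow_pos_of_pos hε _
  have e1 : ε ^ (N : ℝ) * ε ^ ((N : ℝ) - 2 * N) = 1 := by
    rw [← Real.rpow_add hε, show (N : ℝ) + (N - 2 * N) = 0 by ring, Real.rpow_zero]
  have e2 : ((N : ℝ) - 2) / 4 * critExp N = N / 2 := by linarith
  rw [lpNorm_truncBubble_rpow hN hξ (critExp_pos hN) hε, hm, e2, bubbleEnergy, ← hκ,
    Real.norm_eq_abs, Real.norm_of_nonneg hεp.le]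
  calc _ = |κ * ε ^ (N : ℝ) * ((∫ x, ξ x ^ critExp N * kernel N ε x) -
        ε ^ ((N : ℝ) - 2 * N) * kernelInt N N)| := by
        congr 1
        linear_combination (κ * kernelInt N N) * e1
    _ = κ * ε ^ (N : ℝ) * |(∫ x, ξ x ^ critExp N * kernel N ε x) -
        ε ^ ((N : ℝ) - 2 * N) * kernelInt N N| := by
        rw [abs_mul, abs_of_pos (by positivity)]
    _ ≤ κ * ε ^ (N : ℝ) * (2 ^ (N : ℝ) * kernelInt N N) := by gcongr
    _ = _ := by ring

end Trunc

/-! ### The best Sobolev constant -/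

variable {N : ℕ}

lemma one_le_critExp (hN : 3 ≤ N) : 1 ≤ ENNReal.ofReal (critExp N) := by
  have h3 := three_le_cast hN
  rw [ENNReal.one_le_ofReal, critExp, le_div_iff₀ (by linarith)]
  linarith

lemma memLp_of_test {F : Type*} [NormedAddCommGroup F] {f : E N → F} (hf : Continuous f)
    (hc : HasCompactSupport f) (p : ENNReal) : MemLp f p volume :=
  hf.memLp_of_hasCompactSupport hc

lemma sobolev_inequality_lpNorm_test (hN : 3 ≤ N) {φ : E N → ℝ} (hφ : ContDiff ℝ ∞ φ)
    (hc : HasCompactSupport φ) :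
    bubbleEnergy N ^ (1 / N : ℝ) * lpNorm φ (ENNReal.ofReal (critExp N)) volume ≤
      lpNorm (∇ φ) 2 volume := by
  have hm := critExp_pos hN
  have h := sobolev_inequality_test hN hφ hc
  have h1 := lpNorm_rpow (q := critExp N) hφ.continuous.aestronglyMeasurable hm
  have h2 := lpNorm_two_sq (continuous_gradient hφ).aestronglyMeasurable
  simp only [Real.norm_eq_abs] at h1
  rwa [← h1, ← h2, Real.sqrt_sq lpNorm_nonneg, ← Real.rpow_mul lpNorm_nonneg,
    mul_one_div_cancel hm.ne', Real.rpow_one] at h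

lemma tendsto_lpNorm {F : Type*} [NormedAddCommGroup F] {f : E N → F} {φ : ℕ → E N → F}
    {p : ENNReal} (hp : 1 ≤ p) (hf : MemLp f p volume) (hφ : ∀ n, MemLp (φ n) p volume)
    (h : Tendsto (fun n => eLpNorm (fun x => φ n x - f x) p volume) atTop (𝓝 0)) :
    Tendsto (fun n => lpNorm (φ n) p volume) atTop (𝓝 (lpNorm f p volume)) := by
  have h1 : Tendsto (fun n => lpNorm (φ n - f) p volume) atTop (𝓝 0) := by
    have := (ENNReal.tendsto_toReal ENNReal.zero_ne_top).comp h
    refine this.congr fun n => ?_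
    exact toReal_eLpNorm ((hφ n).sub hf).1
  rw [tendsto_iff_dist_tendsto_zero]
  refine squeeze_zero (fun _ => dist_nonneg) (fun n => ?_) h1
  rw [Real.dist_eq, abs_le]
  constructor
  · linarith [lpNorm_le_lpNorm_add_lpNorm_sub (μ := volume) (f := f) (hφ n) hp]
  · linarith [lpNorm_le_lpNorm_add_lpNorm_sub' (μ := volume) (f := φ n) hf hp]

/-- Both norms pass to the limit along the approximating test functions. -/
theorem sobolev_inequality (hN : 3 ≤ N) {f : E N → ℝ} {g : E N → E N}
    (h : MemHomogSobolev N f g) :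
    bubbleEnergy N ^ (1 / N : ℝ) * lpNorm f (ENNReal.ofReal (critExp N)) volume ≤
      lpNorm g 2 volume := by
  obtain ⟨hf, hg, φ, hφ, h1, h2⟩ := h
  have t1 := tendsto_lpNorm (one_le_critExp hN) hf
    (fun n => memLp_of_test (hφ n).1.continuous (hφ n).2 _) h1
  have t2 := tendsto_lpNorm one_le_two hg
    (fun n => memLp_of_test (continuous_gradient (hφ n).1) (hasCompactSupport_gradient (hφ n).2) _)
    h2
  exact le_of_tendsto_of_tendsto' (t1.const_mul _) t2 fun n =>
    sobolev_inequality_lpNorm_test hN (hφ n).1 (hφ n).2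

lemma memHomogSobolev_test {φ : E N → ℝ} (hφ : ContDiff ℝ ∞ φ) (hc : HasCompactSupport φ) :
    MemHomogSobolev N φ (∇ φ) :=
  ⟨memLp_of_test hφ.continuous hc _,
    memLp_of_test (continuous_gradient hφ) (hasCompactSupport_gradient hc) _,
    fun _ => φ, fun _ => ⟨hφ, hc⟩, by simp, by simp⟩

lemma tendsto_rpow_nhdsGT_zero {p : ℝ} (hp : 0 < p) :
    Tendsto (fun ε : ℝ => ε ^ p) (𝓝[>] 0) (𝓝 0) := by
  have := (Real.continuousAt_rpow_const 0 p (Or.inr hp.le)).tendsto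
  rw [Real.zero_rpow hp.ne'] at this
  exact this.mono_left nhdsWithin_le_nhds

lemma tendsto_of_isBigO_rpow {f : ℝ → ℝ} {c p : ℝ} (hp : 0 < p)
    (h : (fun ε => f ε - c) =O[𝓝[>] 0] fun ε : ℝ => ε ^ p) : Tendsto f (𝓝[>] 0) (𝓝 c) := by
  have := h.trans_tendsto (tendsto_rpow_nhdsGT_zero hp)
  simpa using this.add_const c

/-- The best Sobolev constant in terms of the energy of the bubbles. -/
theorem sobolevConst_eq (hN : 3 ≤ N) {ξ : E N → ℝ} (hξ : IsCutoff N ξ) :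
    sobolevConst N = bubbleEnergy N ^ (2 / N : ℝ) := by
  have h3 := three_le_cast hN
  have hK := bubbleEnergy_pos hN
  have hm := critExp_pos hN
  refine IsGreatest.csSup_eq ⟨fun f g h => ?_, fun s hs => ?_⟩
  · have h1 := sobolev_inequality hN h
    have h0 : 0 ≤ bubbleEnergy N ^ (1 / N : ℝ) * lpNorm f (ENNReal.ofReal (critExp N)) volume :=
      mul_nonneg (Real.rpow_nonneg hK.le _) lpNorm_nonneg
    have h2 := pow_le_pow_left₀ h0 h1 2
    rw [mul_pow, ← Real.rpow_natCast (_ ^ (1 / N : ℝ)) 2, ← Real.rpow_mul hK.le] at h2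
    rwa [show (1 / N : ℝ) * (2 : ℕ) = 2 / N by push_cast; ring] at h2
  -- An admissible s is tested on truncated bubbles. In the limit s K^{2/2*} ≤ K with K the bubble
  -- energy, and 2/N + 2/2* = 1 gives s ≤ K^{2/N}.
  · have t1 := tendsto_of_isBigO_rpow (by linarith) (isBigO_gradient_truncBubble hN hξ)
    have t2 := tendsto_of_isBigO_rpow (by linarith) (isBigO_truncBubble_critExp hN hξ)
    have t3 := t2.rpow_const (p := 2 / critExp N) (Or.inl hK.ne')
    have hle := le_of_tendsto_of_tendsto (t3.const_mul s) t1 (by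
      filter_upwards [self_mem_nhdsWithin] with ε (hε : 0 < ε)
      have := hs _ _ (memHomogSobolev_test (contDiff_truncBubble hξ hε)
        (hasCompactSupport_truncBubble hξ ε))
      rwa [← Real.rpow_mul lpNorm_nonneg, mul_div_cancel₀ _ hm.ne', Real.rpow_two])
    have e : bubbleEnergy N = bubbleEnergy N ^ (2 / N : ℝ) * bubbleEnergy N ^ (2 / critExp N) := by
      rw [← Real.rpow_add hK, critExp]
      have : (2 : ℝ) / N + 2 / (2 * N / (N - 2)) = 1 := by
        have : (N : ℝ) - 2 ≠ 0 := by linarith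
        field_simp; ring
      rw [this, Real.rpow_one]
    conv_rhs at hle => rw [e]
    exact le_of_mul_le_mul_right hle (Real.rpow_pos_of_pos hK _)

theorem sobolevConst_rpow (hN : 3 ≤ N) {ξ : E N → ℝ} (hξ : IsCutoff N ξ) :
    sobolevConst N ^ ((N : ℝ) / 2) = bubbleEnergy N := by
  have h3 := three_le_cast hN
  have : (N : ℝ) ≠ 0 := by linarith
  rw [sobolevConst_eq hN hξ, ← Real.rpow_mul (bubbleEnergy_pos hN).le]
  field_simp
  exact Real.rpow_one _

/-! ### Subcritical norms of the truncated bubble -/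

variable {N : ℕ} {ξ : E N → ℝ}

/-- The truncation error is O(ε^β), which is negligible against ε^{N-β} because 2β > N. -/
theorem isLittleO_truncBubble_of_lt (hN : 3 ≤ N) (hξ : IsCutoff N ξ) {q : ℝ}
    (hq : (N : ℝ) / ((N : ℝ) - 2) < q) :
    ∃ K : ℝ, 0 < K ∧
      (fun ε : ℝ => lpNorm (truncBubble N ξ ε) (ENNReal.ofReal q) volume ^ q -
          K * ε ^ ((N : ℝ) - ((N : ℝ) - 2) / 2 * q))
        =o[𝓝[>] 0] fun ε : ℝ => ε ^ ((N : ℝ) - ((N : ℝ) - 2) / 2 * q) := by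
  have h3 := three_le_cast hN
  have hc := bubbleConst_pos hN
  rw [div_lt_iff₀ (by linarith)] at hq
  have hq0 : 0 < q := by nlinarith
  set β := ((N : ℝ) - 2) / 2 * q with hβ
  have hβN : (N : ℝ) < 2 * β := by rw [hβ]; linarith
  set κ := ((N : ℝ) * (N - 2)) ^ (((N : ℝ) - 2) / 4 * q) with hκ
  have hκ0 : 0 < κ := Real.rpow_pos_of_pos hc _
  refine ⟨κ * kernelInt N β, mul_pos hκ0 (kernelInt_pos hβN), ?_⟩
  have hO : (fun ε : ℝ => lpNorm (truncBubble N ξ ε) (ENNReal.ofReal q) volume ^ q -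
      κ * kernelInt N β * ε ^ ((N : ℝ) - β)) =O[𝓝[>] 0] fun ε : ℝ => ε ^ β := by
    refine IsBigO.of_bound (κ * (2 ^ β * kernelInt N β)) ?_
    filter_upwards [self_mem_nhdsWithin] with ε (hε : 0 < ε)
    have hεp : 0 < ε ^ β := Real.rpow_pos_of_pos hε _
    have h := abs_integral_cutoff_mul_kernel_sub_le hN hξ hq0 hβN hε
    have e1 : ε ^ β * ε ^ ((N : ℝ) - 2 * β) = ε ^ ((N : ℝ) - β) := by
      rw [← Real.rpow_add hε]; ring_nf
    rw [lpNorm_truncBubble_rpow hN hξ hq0 hε, ← hβ, ← hκ, ← e1, Real.norm_eq_abs,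
      Real.norm_of_nonneg hεp.le]
    calc _ = |κ * ε ^ β * ((∫ x, ξ x ^ q * kernel β ε x) -
          ε ^ ((N : ℝ) - 2 * β) * kernelInt N β)| := by
          congr 1; ring
      _ = κ * ε ^ β * |(∫ x, ξ x ^ q * kernel β ε x) -
          ε ^ ((N : ℝ) - 2 * β) * kernelInt N β| := by
          rw [abs_mul, abs_of_pos (by positivity)]
      _ ≤ κ * ε ^ β * (2 ^ β * kernelInt N β) := by gcongr
      _ = _ := by ring
  refine hO.trans_isLittleO ?_
  have ho : (fun ε : ℝ => ε ^ (2 * β - N)) =o[𝓝[>] 0] fun _ : ℝ => (1 : ℝ) :=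
    (isLittleO_one_iff ℝ).2 (tendsto_rpow_nhdsGT_zero (by linarith))
  have := ho.mul_isBigO (isBigO_refl (fun ε : ℝ => ε ^ ((N : ℝ) - β)) (𝓝[>] 0))
  refine this.congr' ?_ (Eventually.of_forall fun ε => one_mul _)
  filter_upwards [self_mem_nhdsWithin] with ε (hε : 0 < ε)
  rw [← Real.rpow_add hε]
  ring_nf

/-! #### The logarithmic case -/

/-- The radial density of `kernel (N / 2) ε`. -/
def logDensity (N : ℕ) (ε r : ℝ) : ℝ := r ^ (N - 1) * (ε ^ 2 + r ^ 2) ^ (-((N : ℝ) / 2))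

lemma continuous_logDensity {ε : ℝ} (hε : 0 < ε) : Continuous (logDensity N ε) :=
  (continuous_pow _).mul (Continuous.rpow_const (by fun_prop) fun r => Or.inl (by positivity))

/-- From r^{N-1} ≤ (ε²+r²)^{(N-1)/2} the density is at most (ε²+r²)^{-1/2}. It is used with s = ε on
[0, ε] and s = r on [ε, 1]. -/
lemma logDensity_le (hN : 3 ≤ N) {ε r s : ℝ} (hε : 0 < ε) (hr : 0 ≤ r) (hs : 0 < s)
    (hsle : s ^ 2 ≤ ε ^ 2 + r ^ 2) : logDensity N ε r ≤ s⁻¹ := by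
  have hb : 0 < ε ^ 2 + r ^ 2 := by positivity
  set b := ε ^ 2 + r ^ 2 with hbdef
  have h1 : r ^ (N - 1) ≤ b ^ (((N : ℝ) - 1) / 2) := by
    calc r ^ (N - 1) = (r ^ 2) ^ (((N : ℝ) - 1) / 2) := by
          rw [← Real.rpow_natCast r 2, ← Real.rpow_mul hr, ← Real.rpow_natCast]
          congr 1
          rw [Nat.cast_sub (by omega)]; push_cast; ring
      _ ≤ _ := Real.rpow_le_rpow (by positivity) (by rw [hbdef]; linarith [sq_nonneg ε])
          (by linarith [three_le_cast hN])
  calc logDensity N ε r ≤ b ^ (((N : ℝ) - 1) / 2) * b ^ (-((N : ℝ) / 2)) :=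
        mul_le_mul_of_nonneg_right h1 (Real.rpow_nonneg hb.le _)
    _ = b ^ (-(1 / 2) : ℝ) := by rw [← Real.rpow_add hb]; ring_nf
    _ ≤ (s ^ 2) ^ (-(1 / 2) : ℝ) :=
        Real.rpow_le_rpow_of_nonpos (by positivity) hsle (by norm_num)
    _ = s⁻¹ := by
        rw [← Real.rpow_natCast s 2, ← Real.rpow_mul hs.le, ← Real.rpow_neg_one]
        congr 1; push_cast; ring

/-- With z = ε²/r², the bounds log(1+z) ≤ z and exp t ≥ 1 + t give (1+z)^{-N/2} ≥ 1 - Nz/2. -/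
lemma le_logDensity (hN : 3 ≤ N) {ε r : ℝ} (hr : 0 < r) :
    r⁻¹ - N / 2 * ε ^ 2 * r ^ (-3 : ℤ) ≤ logDensity N ε r := by
  set z := ε ^ 2 / r ^ 2 with hz
  have hz0 : 0 ≤ z := by positivity
  have hb : ε ^ 2 + r ^ 2 = r ^ 2 * (1 + z) := by rw [hz]; field_simp; ring
  have h1 : 1 - N / 2 * z ≤ (1 + z) ^ (-((N : ℝ) / 2)) := by
    rw [Real.rpow_def_of_pos (by positivity)]
    have hl : Real.log (1 + z) ≤ z := by
      have := Real.log_le_sub_one_of_pos (show 0 < 1 + z by positivity)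
      linarith
    have := Real.add_one_le_exp (Real.log (1 + z) * -((N : ℝ) / 2))
    have hN0 : (0 : ℝ) ≤ N / 2 := by positivity
    nlinarith [mul_le_mul_of_nonneg_left hl hN0]
  have h2 : r ^ (N - 1) * (r ^ 2) ^ (-((N : ℝ) / 2)) = r⁻¹ := by
    rw [← Real.rpow_natCast r 2, ← Real.rpow_mul hr.le, ← Real.rpow_natCast r (N - 1),
      ← Real.rpow_add hr, ← Real.rpow_neg_one]
    congr 1
    rw [Nat.cast_sub (by omega)]; push_cast; ring
  rw [logDensity, hb, Real.mul_rpow (by positivity) (by positivity), ← mul_assoc, h2]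
  calc r⁻¹ - N / 2 * ε ^ 2 * r ^ (-3 : ℤ) = r⁻¹ * (1 - N / 2 * z) := by
        rw [hz]; field_simp
    _ ≤ _ := mul_le_mul_of_nonneg_left h1 (by positivity)

/-- Split at r = ε. The inner part is at most 1; on [ε, 1] comparison with 1/r produces |log ε|, and
the correction (N/2)ε² ∫ r⁻³ is at most N/4. -/
lemma abs_integral_logDensity_sub_le (hN : 3 ≤ N) {ε : ℝ} (hε : 0 < ε) (hε1 : ε < 1) :
    |(∫ r in (0 : ℝ)..1, logDensity N ε r) - abs (Real.log ε)| ≤ 1 + N / 4 := by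
  have hlog : |Real.log ε| = ∫ r in ε..1, r⁻¹ := by
    rw [integral_inv_of_pos hε one_pos, abs_of_neg (Real.log_neg hε hε1), one_div, Real.log_inv]
  have hi : ∀ a b, IntervalIntegrable (logDensity N ε) volume a b := fun a b =>
    (continuous_logDensity hε).intervalIntegrable a b
  have hinv : IntervalIntegrable (fun r : ℝ => r⁻¹) volume ε 1 :=
    intervalIntegral.intervalIntegrable_inv (fun r hr => by
      rw [Set.uIcc_of_le hε1.le] at hr
      linarith [hr.1]) continuousOn_id
  have hcube : IntervalIntegrable (fun r : ℝ => r ^ (-3 : ℤ)) volume ε 1 :=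
    intervalIntegral.intervalIntegrable_zpow (Or.inr fun h => by
      rw [Set.uIcc_of_le hε1.le] at h
      linarith [h.1])
  have h1 : ∫ r in (0 : ℝ)..ε, logDensity N ε r ≤ 1 := by
    calc ∫ r in (0 : ℝ)..ε, logDensity N ε r ≤ ∫ r in (0 : ℝ)..ε, ε⁻¹ :=
          intervalIntegral.integral_mono_on hε.le (hi _ _) intervalIntegrable_const fun r hr =>
            logDensity_le hN hε hr.1 hε (by linarith [sq_nonneg r])
      _ = 1 := by simp [hε.ne']
  have h0 : 0 ≤ ∫ r in (0 : ℝ)..ε, logDensity N ε r :=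
    intervalIntegral.integral_nonneg hε.le fun r hr =>
      mul_nonneg (pow_nonneg hr.1 _) (by positivity)
  have h2 : ∫ r in ε..1, logDensity N ε r ≤ ∫ r in ε..1, r⁻¹ :=
    intervalIntegral.integral_mono_on hε1.le (hi _ _) hinv fun r hr =>
      logDensity_le hN hε (by linarith [hr.1]) (by linarith [hr.1]) (by linarith [sq_nonneg ε])
  have h4 : (∫ r in ε..1, r⁻¹) - N / 4 ≤ ∫ r in ε..1, logDensity N ε r := by
    have hmono : ∫ r in ε..1, (r⁻¹ - N / 2 * ε ^ 2 * r ^ (-3 : ℤ)) ≤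
        ∫ r in ε..1, logDensity N ε r :=
      intervalIntegral.integral_mono_on hε1.le (hinv.sub (hcube.const_mul _)) (hi _ _)
        fun r hr => le_logDensity hN (by linarith [hr.1])
    rw [intervalIntegral.integral_sub hinv (hcube.const_mul _),
      intervalIntegral.integral_const_mul, integral_zpow (Or.inr ⟨by norm_num, fun h => by
        rw [Set.uIcc_of_le hε1.le] at h
        linarith [h.1]⟩)] at hmono
    refine le_trans ?_ hmono
    have : (N : ℝ) / 2 * ε ^ 2 * (((1 : ℝ) ^ (-3 + 1 : ℤ) - ε ^ (-3 + 1 : ℤ)) / ((-3 : ℤ) + 1)) =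
        N / 4 - N / 4 * ε ^ 2 := by
      norm_num
      field_simp
      ring
    rw [this]
    have : 0 ≤ (N : ℝ) / 4 * ε ^ 2 := by positivity
    linarith
  rw [hlog, ← intervalIntegral.integral_add_adjacent_intervals (hi 0 ε) (hi ε 1), abs_le]
  have : (0 : ℝ) ≤ N / 4 := by positivity
  constructor <;> linarith

lemma setIntegral_ball_kernel (hN : 3 ≤ N) (ε : ℝ) :
    ∫ x in Metric.ball (0 : E N) 1, kernel ((N : ℝ) / 2) ε x =
      sphereArea N * ∫ r in (0 : ℝ)..1, logDensity N ε r := by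
  have h := integral_radial hN
    ((Set.Iio (1 : ℝ)).indicator fun r => (ε ^ 2 + r ^ 2) ^ (-((N : ℝ) / 2)))
  rw [← integral_indicator Metric.isOpen_ball.measurableSet]
  have e : ∀ x : E N, (Metric.ball (0 : E N) 1).indicator (kernel ((N : ℝ) / 2) ε) x =
      (Set.Iio (1 : ℝ)).indicator (fun r => (ε ^ 2 + r ^ 2) ^ (-((N : ℝ) / 2))) ‖x‖ := fun x => by
    by_cases hx : ‖x‖ < 1
    · rw [Set.indicator_of_mem (by simpa using hx), Set.indicator_of_mem (by simpa using hx),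
        kernel]
    · rw [Set.indicator_of_notMem (by simpa using hx), Set.indicator_of_notMem (by simpa using hx)]
  simp only [e, h]
  congr 1
  rw [intervalIntegral.integral_of_le zero_le_one, integral_Ioc_eq_integral_Ioo]
  have e2 : ∀ r : ℝ, r ^ (N - 1) * (Set.Iio (1 : ℝ)).indicator
      (fun r => (ε ^ 2 + r ^ 2) ^ (-((N : ℝ) / 2))) r =
      (Set.Iio (1 : ℝ)).indicator (logDensity N ε) r := fun r => by
    by_cases hr : r < 1
    · rw [Set.indicator_of_mem (by simpa using hr), Set.indicator_of_mem (by simpa using hr),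
        logDensity]
    · rw [Set.indicator_of_notMem (by simpa using hr), Set.indicator_of_notMem (by simpa using hr),
        mul_zero]
  simp only [e2]
  rw [setIntegral_indicator measurableSet_Iio, Set.Ioi_inter_Iio]

/-- At 2β = N the kernel is not integrable at infinity for a uniform tail bound, so the comparison
is with the unit ball and the cut-off is kept in the majorant. -/
lemma integral_cutoff_mul_kernel_mem (hN : 3 ≤ N) (hξ : IsCutoff N ξ) {q ε : ℝ} (hq : 0 < q)
    (hε : 0 < ε) :
    |(∫ x, ξ x ^ q * kernel ((N : ℝ) / 2) ε x) -
      ∫ x in Metric.ball (0 : E N) 1, kernel ((N : ℝ) / 2) ε x| ≤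
      2 ^ ((N : ℝ) / 2) * ∫ x, ξ x ^ q * kernel ((N : ℝ) / 2) 1 x := by
  have hi := hξ.integrable_rpow_mul_kernel (β := (N : ℝ) / 2) hq hε
  have hi1 := hξ.integrable_rpow_mul_kernel (β := (N : ℝ) / 2) hq one_pos
  have hnn : ∀ {ε : ℝ}, 0 < ε → ∀ x, 0 ≤ ξ x ^ q * kernel ((N : ℝ) / 2) ε x := fun h x =>
    mul_nonneg (hξ.rpow_mem hN hq.le x).1 (kernel_pos h x).le
  have hms : MeasurableSet (Metric.ball (0 : E N) 1) := Metric.isOpen_ball.measurableSet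
  have hball : ∫ x in Metric.ball (0 : E N) 1, kernel ((N : ℝ) / 2) ε x =
      ∫ x in Metric.ball (0 : E N) 1, ξ x ^ q * kernel ((N : ℝ) / 2) ε x :=
    setIntegral_congr_fun hms fun x hx => by
      simp only [hξ.eq_one x hx, Real.one_rpow, one_mul]
  rw [hball, ← integral_add_compl hms hi, add_sub_cancel_left,
    abs_of_nonneg (integral_nonneg fun x => hnn hε x), ← integral_const_mul]
  calc _ ≤ ∫ x in (Metric.ball (0 : E N) 1)ᶜ,
        2 ^ ((N : ℝ) / 2) * (ξ x ^ q * kernel ((N : ℝ) / 2) 1 x) := by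
        refine setIntegral_mono_on hi.integrableOn (hi1.const_mul _).integrableOn hms.compl
          fun x hx => ?_
        have := kernel_le (β := (N : ℝ) / 2) (by positivity) hε (x := x) (by simpa using hx)
        have := mul_le_mul_of_nonneg_left this (hξ.rpow_mem hN hq.le x).1
        linarith
    _ ≤ _ := setIntegral_le_integral (hi1.const_mul _) (Eventually.of_forall fun x =>
        mul_nonneg (by positivity) (hnn one_pos x))

theorem isBigO_truncBubble_log (hN : 3 ≤ N) (hξ : IsCutoff N ξ) {q : ℝ}
    (hq : q = (N : ℝ) / ((N : ℝ) - 2)) :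
    (fun ε : ℝ => lpNorm (truncBubble N ξ ε) (ENNReal.ofReal q) volume ^ q -
        ((N : ℝ) * ((N : ℝ) - 2)) ^ ((N : ℝ) / 4) * sphereArea N * ε ^ ((N : ℝ) / 2) *
          |Real.log ε|)
      =O[𝓝[>] 0] fun ε : ℝ => ε ^ ((N : ℝ) / 2) := by
  have h3 := three_le_cast hN
  have hN2 : (N : ℝ) - 2 ≠ 0 := by linarith
  have hc := bubbleConst_pos hN
  have hω := sphereArea_pos hN
  have hq0 : 0 < q := by rw [hq]; exact div_pos (by linarith) (by linarith)
  have e1 : ((N : ℝ) - 2) / 2 * q = N / 2 := by rw [hq]; field_simp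
  have e2 : ((N : ℝ) - 2) / 4 * q = N / 4 := by rw [hq]; field_simp
  set κ := ((N : ℝ) * ((N : ℝ) - 2)) ^ ((N : ℝ) / 4) with hκ
  have hκ0 : 0 < κ := Real.rpow_pos_of_pos hc _
  set C := 2 ^ ((N : ℝ) / 2) * ∫ x, ξ x ^ q * kernel ((N : ℝ) / 2) 1 x with hC
  refine IsBigO.of_bound (κ * (C + sphereArea N * (1 + N / 4))) ?_
  filter_upwards [Ioo_mem_nhdsGT one_pos] with ε hε
  have hε0 : 0 < ε := hε.1
  have hεp : 0 < ε ^ ((N : ℝ) / 2) := Real.rpow_pos_of_pos hε0 _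
  have h1 := integral_cutoff_mul_kernel_mem hN hξ hq0 hε0
  have h2 := abs_integral_logDensity_sub_le hN hε0 hε.2
  rw [setIntegral_ball_kernel hN ε, ← hC] at h1
  rw [lpNorm_truncBubble_rpow hN hξ hq0 hε0, e1, e2, Real.norm_eq_abs, Real.norm_of_nonneg hεp.le]
  set I := ∫ x, ξ x ^ q * kernel ((N : ℝ) / 2) ε x
  set J := ∫ r in (0 : ℝ)..1, logDensity N ε r
  have h4 : |I - sphereArea N * abs (Real.log ε)| ≤ C + sphereArea N * (1 + N / 4) := by
    calc |I - sphereArea N * abs (Real.log ε)| =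
          |(I - sphereArea N * J) + sphereArea N * (J - abs (Real.log ε))| := by congr 1; ring
      _ ≤ |I - sphereArea N * J| + |sphereArea N * (J - abs (Real.log ε))| := abs_add_le _ _
      _ ≤ _ := by
        rw [abs_mul, abs_of_pos hω]
        exact add_le_add h1 (mul_le_mul_of_nonneg_left h2 hω.le)
  calc _ = |κ * ε ^ ((N : ℝ) / 2) * (I - sphereArea N * abs (Real.log ε))| := by congr 1; ring
    _ = κ * ε ^ ((N : ℝ) / 2) * |I - sphereArea N * abs (Real.log ε)| := by
        rw [abs_mul, abs_of_pos (by positivity)]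
    _ ≤ κ * ε ^ ((N : ℝ) / 2) * (C + sphereArea N * (1 + N / 4)) := by gcongr
    _ = _ := by ring

/-! #### The case of small exponents -/

lemma IsCutoff.eq_radial (hξ : IsCutoff N ξ) {e : E N} (he : ‖e‖ = 1) (x : E N) :
    ξ x = ξ (‖x‖ • e) := by
  have : ‖‖x‖ • e‖ = ‖x‖ := by rw [norm_smul, he, mul_one, norm_norm]
  exact le_antisymm (hξ.antitone _ _ this.le) (hξ.antitone _ _ this.ge)

/-- The singularity at 0 is integrable because (N-2)q - (N-1) < 1 exactly when q < N/(N-2). -/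
lemma IsCutoff.intervalIntegrable_radial (hN : 3 ≤ N) (hξ : IsCutoff N ξ) {q : ℝ} (hq : 0 < q)
    (hq1 : q < (N : ℝ) / ((N : ℝ) - 2)) (e : E N) :
    IntervalIntegrable (fun r : ℝ => ξ (r • e) ^ q / r ^ (((N : ℝ) - 2) * q - ((N : ℝ) - 1)))
      volume 0 2 := by
  have h3 := three_le_cast hN
  rw [lt_div_iff₀ (by linarith)] at hq1
  have h1 : IntervalIntegrable (fun r : ℝ => r ^ (-(((N : ℝ) - 2) * q - ((N : ℝ) - 1)))) volume 0 2 :=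
    intervalIntegral.intervalIntegrable_rpow' (by linarith)
  have h2 : Continuous fun r : ℝ => ξ (r • e) ^ q :=
    (hξ.continuous_rpow hq.le).comp (by fun_prop : Continuous fun r : ℝ => r • e)
  refine (h1.continuousOn_mul h2.continuousOn).congr fun r hr => ?_
  rw [Set.uIoc_of_le zero_le_two] at hr
  rw [Real.rpow_neg hr.1.le, div_eq_mul_inv]

/-- Polar coordinates: the weight r^{N-1} shifts the exponent, radiality of ξ allows any unit vector
e, and the integrand vanishes beyond r = 2. -/
lemma radial_cutoff (hN : 3 ≤ N) (hξ : IsCutoff N ξ) {q : ℝ} (hq : 0 < q)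
    (hq1 : q < (N : ℝ) / ((N : ℝ) - 2)) {e : E N} (he : ‖e‖ = 1) :
    Integrable (fun x : E N => ξ x ^ q * ‖x‖ ^ (-(((N : ℝ) - 2) * q))) ∧
    ∫ x : E N, ξ x ^ q * ‖x‖ ^ (-(((N : ℝ) - 2) * q)) = sphereArea N *
      ∫ r in (0 : ℝ)..2, ξ (r • e) ^ q / r ^ (((N : ℝ) - 2) * q - ((N : ℝ) - 1)) := by
  set g : ℝ → ℝ := fun r => ξ (r • e) ^ q / r ^ (((N : ℝ) - 2) * q - ((N : ℝ) - 1)) with hg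
  have hint := hξ.intervalIntegrable_radial hN hq hq1 e
  rw [intervalIntegrable_iff_integrableOn_Ioc_of_le zero_le_two] at hint
  set f : ℝ → ℝ := fun r => ξ (r • e) ^ q * r ^ (-(((N : ℝ) - 2) * q)) with hf
  have hfx : ∀ x : E N, ξ x ^ q * ‖x‖ ^ (-(((N : ℝ) - 2) * q)) = f ‖x‖ := fun x => by
    rw [hf, hξ.eq_radial he x]
  have hfg : Set.EqOn (fun r : ℝ => r ^ (N - 1) * f r) ((Set.Ioc 0 2).indicator g)
      (Set.Ioi 0) := by
    intro r (hr : 0 < r)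
    simp only
    rcases le_or_gt r 2 with h | h
    · rw [Set.indicator_of_mem (show r ∈ Set.Ioc 0 2 from ⟨hr, h⟩), hg, hf]
      simp only
      rw [Real.rpow_sub hr, Real.rpow_neg hr.le, ← Real.rpow_natCast, Nat.cast_sub (by omega),
        Nat.cast_one]
      have := (Real.rpow_pos_of_pos hr (((N : ℝ) - 2) * q)).ne'
      have := (Real.rpow_pos_of_pos hr ((N : ℝ) - 1)).ne'
      field_simp
    · rw [Set.indicator_of_notMem (fun h2 => absurd h2.2 (not_le.2 h)), hf]
      have : ξ (r • e) = 0 := hξ.eq_zero _ (by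
        simp [norm_smul, he, abs_of_pos hr, h.le])
      simp only [this, Real.zero_rpow hq.ne', zero_mul, mul_zero]
  have hsub : Set.Ioi (0 : ℝ) ∩ Set.Ioc 0 2 = Set.Ioc 0 2 :=
    Set.inter_eq_right.2 fun r hr => hr.1
  simp only [hfx]
  constructor
  · rw [integrable_radial hN, integrableOn_congr_fun hfg measurableSet_Ioi]
    exact ((integrable_indicator_iff measurableSet_Ioc).2 hint).integrableOn
  · rw [integral_radial hN, setIntegral_congr_fun measurableSet_Ioi hfg,
      setIntegral_indicator measurableSet_Ioc, hsub, intervalIntegral.integral_of_le zero_le_two]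

/-- Dropping ε² only increases the kernel, so the limit itself is an integrable majorant. -/
lemma tendsto_integral_cutoff_mul_kernel (hN : 3 ≤ N) (hξ : IsCutoff N ξ) {q : ℝ} (hq : 0 < q)
    (hi : Integrable (fun x : E N => ξ x ^ q * ‖x‖ ^ (-(((N : ℝ) - 2) * q)))) :
    Tendsto (fun ε : ℝ => ∫ x, ξ x ^ q * kernel (((N : ℝ) - 2) / 2 * q) ε x) (𝓝[>] 0)
      (𝓝 (∫ x : E N, ξ x ^ q * ‖x‖ ^ (-(((N : ℝ) - 2) * q)))) := by
  have h3 := three_le_cast hN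
  have := nontrivial_of_three_le hN
  have hβ : 0 < ((N : ℝ) - 2) / 2 * q := mul_pos (by linarith) hq
  -- The origin is excluded because `Real.rpow` sends 0 with a negative exponent to 0, where the
  -- majorant would fail.
  have hx0 : ∀ᵐ x : E N, x ≠ 0 := Measure.ae_ne volume 0
  have hpow : ∀ x : E N, (‖x‖ ^ 2) ^ (-(((N : ℝ) - 2) / 2 * q)) = ‖x‖ ^ (-(((N : ℝ) - 2) * q)) :=
    fun x => by
      rw [← Real.rpow_natCast, ← Real.rpow_mul (norm_nonneg x)]
      congr 1; push_cast; ring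
  refine tendsto_integral_filter_of_dominated_convergence _ ?_ ?_ hi ?_
  · filter_upwards [self_mem_nhdsWithin] with ε (hε : 0 < ε)
    exact (hξ.integrable_rpow_mul_kernel hq hε).1
  · filter_upwards [self_mem_nhdsWithin] with ε (hε : 0 < ε)
    filter_upwards [hx0] with x hx
    have hxn : 0 < ‖x‖ := norm_pos_iff.2 hx
    rw [Real.norm_of_nonneg (mul_nonneg (hξ.rpow_mem hN hq.le x).1 (kernel_pos hε x).le), ← hpow]
    refine mul_le_mul_of_nonneg_left ?_ (hξ.rpow_mem hN hq.le x).1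
    exact Real.rpow_le_rpow_of_nonpos (by positivity) (by linarith [sq_nonneg ε]) (by linarith)
  · filter_upwards [hx0] with x hx
    have hxn : 0 < ‖x‖ := norm_pos_iff.2 hx
    rw [← hpow]
    refine Tendsto.const_mul _ ?_
    have h1 : Tendsto (fun ε : ℝ => ε ^ 2 + ‖x‖ ^ 2) (𝓝[>] 0) (𝓝 (‖x‖ ^ 2)) := by
      have : Continuous fun ε : ℝ => ε ^ 2 + ‖x‖ ^ 2 := by fun_prop
      simpa using (this.tendsto 0).mono_left nhdsWithin_le_nhds
    exact h1.rpow_const (Or.inl (by positivity))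

theorem isLittleO_truncBubble_of_gt (hN : 3 ≤ N) (hξ : IsCutoff N ξ) {q : ℝ} (hq : 0 < q)
    (hq1 : q < (N : ℝ) / ((N : ℝ) - 2)) {e : E N} (he : ‖e‖ = 1) :
    (fun ε : ℝ => lpNorm (truncBubble N ξ ε) (ENNReal.ofReal q) volume ^ q -
        ((N : ℝ) * ((N : ℝ) - 2)) ^ (((N : ℝ) - 2) / 4 * q) * sphereArea N *
          (∫ r in (0 : ℝ)..2, ξ (r • e) ^ q / r ^ (((N : ℝ) - 2) * q - ((N : ℝ) - 1))) *
          ε ^ (((N : ℝ) - 2) / 2 * q))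
      =o[𝓝[>] 0] fun ε : ℝ => ε ^ (((N : ℝ) - 2) / 2 * q) := by
  obtain ⟨hi, hI⟩ := radial_cutoff hN hξ hq hq1 he
  have ht := tendsto_integral_cutoff_mul_kernel hN hξ hq hi
  rw [hI] at ht
  set κ := ((N : ℝ) * ((N : ℝ) - 2)) ^ (((N : ℝ) - 2) / 4 * q) with hκ
  have h0 := (ht.sub_const (sphereArea N *
    ∫ r in (0 : ℝ)..2, ξ (r • e) ^ q / r ^ (((N : ℝ) - 2) * q - ((N : ℝ) - 1)))).const_mul κ
  rw [sub_self, mul_zero] at h0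
  have ho := ((isLittleO_one_iff ℝ).2 h0).mul_isBigO
    (isBigO_refl (fun ε : ℝ => ε ^ (((N : ℝ) - 2) / 2 * q)) (𝓝[>] 0))
  refine ho.congr' ?_ (Eventually.of_forall fun ε => one_mul _)
  filter_upwards [self_mem_nhdsWithin] with ε (hε : 0 < ε)
  rw [lpNorm_truncBubble_rpow hN hξ hq hε]
  ring

end TalentiBubble

end

/-! ### The expansions assembled -/

theorem lemma7p1 (N : ℕ) (hN : 3 ≤ N) (ξ : TalentiBubble.E N → ℝ)
    (hξ : TalentiBubble.IsCutoff N ξ) :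
    ((fun ε : ℝ => lpNorm (∇ (TalentiBubble.truncBubble N ξ ε)) 2 volume ^ 2
        - TalentiBubble.sobolevConst N ^ ((N : ℝ) / 2))
      =O[𝓝[>] 0] fun ε : ℝ => ε ^ ((N : ℝ) - 2)) ∧
    ((fun ε : ℝ => lpNorm (TalentiBubble.truncBubble N ξ ε)
          (ENNReal.ofReal (TalentiBubble.critExp N)) volume ^ TalentiBubble.critExp N
        - TalentiBubble.sobolevConst N ^ ((N : ℝ) / 2))
      =O[𝓝[>] 0] fun ε : ℝ => ε ^ (N : ℝ)) ∧
    (∀ q : ℝ, (N : ℝ) / ((N : ℝ) - 2) < q → q < TalentiBubble.critExp N →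
      ∃ K : ℝ, 0 < K ∧
        (fun ε : ℝ => lpNorm (TalentiBubble.truncBubble N ξ ε) (ENNReal.ofReal q) volume ^ q
          - K * ε ^ ((N : ℝ) - ((N : ℝ) - 2) / 2 * q))
        =o[𝓝[>] 0] fun ε : ℝ => ε ^ ((N : ℝ) - ((N : ℝ) - 2) / 2 * q)) ∧
    (∀ q : ℝ, q = (N : ℝ) / ((N : ℝ) - 2) →
      (fun ε : ℝ => lpNorm (TalentiBubble.truncBubble N ξ ε) (ENNReal.ofReal q) volume ^ q
        - ((N : ℝ) * ((N : ℝ) - 2)) ^ ((N : ℝ) / 4) * TalentiBubble.sphereArea N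
            * ε ^ ((N : ℝ) / 2) * |Real.log ε|)
      =O[𝓝[>] 0] fun ε : ℝ => ε ^ ((N : ℝ) / 2)) ∧
    (∀ q : ℝ, 1 ≤ q → q < (N : ℝ) / ((N : ℝ) - 2) →
      ∀ e : TalentiBubble.E N, ‖e‖ = 1 →
        IntervalIntegrable
          (fun r : ℝ => ξ (r • e) ^ q / r ^ (((N : ℝ) - 2) * q - ((N : ℝ) - 1))) volume 0 2 ∧
        (fun ε : ℝ => lpNorm (TalentiBubble.truncBubble N ξ ε) (ENNReal.ofReal q) volume ^ q
          - ((N : ℝ) * ((N : ℝ) - 2)) ^ (((N : ℝ) - 2) / 4 * q) * TalentiBubble.sphereArea N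
              * (∫ r in (0 : ℝ)..2,
                  ξ (r • e) ^ q / r ^ (((N : ℝ) - 2) * q - ((N : ℝ) - 1)))
              * ε ^ (((N : ℝ) - 2) / 2 * q))
        =o[𝓝[>] 0] fun ε : ℝ => ε ^ (((N : ℝ) - 2) / 2 * q)) := by
  -- The sharp Sobolev inequality enters only here, to name the common limit in (i).
  have hK := TalentiBubble.sobolevConst_rpow hN hξ
  refine ⟨?_, ?_, fun q hq _ => TalentiBubble.isLittleO_truncBubble_of_lt hN hξ hq,
    fun q hq => TalentiBubble.isBigO_truncBubble_log hN hξ hq, fun q hq hq1 e he =>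
      ⟨hξ.intervalIntegrable_radial hN (by linarith) hq1 e,
        TalentiBubble.isLittleO_truncBubble_of_gt hN hξ (by linarith) hq1 he⟩⟩
  · rw [hK]
    exact TalentiBubble.isBigO_gradient_truncBubble hN hξ
  · rw [hK]
    exact TalentiBubble.isBigO_truncBubble_critExp hN hξ
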